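/- Notation. For $0<p\le 1$ put $1/p_\#=(1-p)/p$ (so $p_\#=p/(1-p)$, and $p_\#=\infty$, $1/p_\#=0$ when $p=1$), and for $0<p<2$ put $p_\flat=2p/(2-p)$. $S_p$ is the class of bounded operators $T$ on $\ell^2=\ell^2(\mathbb Z_+)$ whose singular numbers satisfy $\sum_{n\ge0}s_n(T)^p<\infty$; operators on $\ell^2$ are identified with their matrices in the standard basis. A matrix $A=\{a_{jk}\}_{j,k\ge0}$ belongs to $\mathfrak M_p$ (is a Schur multiplier of $S_p$) if $\{a_{jk}b_{jk}\}_{j,k\ge0}\in S_p$ for every $\{b_{jk}\}_{j,k\ge0}\in S_p$. For a distribution $\psi$ on the unit circle $\mathbb T$ with Fourier coefficients $\hat\psi(n)$, or for a function $\psi=\sum_{n\ge0}\hat\psi(n)z^n$ analytic in the unit disk $\mathbb D$ (with $\hat\psi(n)=0$ for $n<0$), let $\Gamma_\psi=\{\hat\psi(j+k)\}_{j,k\ge0}$. Let $v\in C^\infty(\mathbb R)$, $v\ge0$, $\operatorname{supp}v=[1/2,2]$, $\sum_{n\ge0}v(x/2^n)=1$ for $x\ge1$, and let $V_n=\sum_{k\ge0}v(k/2^n)z^k$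 for $n\ge1$, $V_0=\bar z+1+z$, $V_n=\overline{V_{-n}}$ for $n<0$. For $s\in\mathbb R$ and $0<p,q\le\infty$, the Besov class $B^s_{p\,q}$ consists of the distributions $\psi$ on $\mathbb T$ with $\{2^{|n|s}\|\psi*V_n\|_{L^p(\mathbb T)}\}_{n\in\mathbb Z}\in\ell^q(\mathbb Z)$; the class $(B^s_{p\,q})_+$ consists of the functions $\psi$ analytic in $\mathbb D$ with $\{2^{ns}\|\psi*V_n\|_{L^p(\mathbb T)}\}_{n\ge0}\in\ell^q$; and $B^s_p=B^s_{p\,p}$. Theorem. Let $0<p\le1$. (1) If $p\le r\le\min\{1,p_\flat\}$ and $\psi\in B^{1/p_\#}_{r\,r_\flat}$, where $r_\flat=2r/(2-r)$, then $\Gamma_\psi\in\mathfrak M_p$. (2) If $\psi\in\bigl(B^{1/p_\#}_{p\,p_\flat}\bigr)_+$, then $\Gamma_\psi\in\mathfrak M_p$. (3) If $p\le 2/3$ and $\psi\in\bigl(B^{1/p_\#}_{p_\flat}\bigr)_+$, then $\Gamma_\psi\in\mathfrak M_p$. -/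

import Mathlib

open scoped ContDiff Matrix

noncomputable section

/-! ### Schatten classes and Schur multipliers on `ℓ²` -/

/-- The Hilbert space `ℓ²` of square summable complex sequences indexed by `0, 1, 2, …`. -/
abbrev SeqHilbert : Type := lp (fun _ : ℕ => ℂ) 2

/-- The singular number `s_n(T)`, `n ≥ 0`: the distance, in the operator norm, from `T` to the
bounded operators of rank at most `n`. -/
def singularNumber (T : SeqHilbert →L[ℂ] SeqHilbert) (n : ℕ) : ℝ :=
  sInf {d : ℝ | ∃ K : SeqHilbert →L[ℂ] SeqHilbert,
    LinearMap.rank (K : SeqHilbert →ₗ[ℂ] SeqHilbert) ≤ (n : Cardinal) ∧ d = ‖T - K‖}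

/-- A bounded operator `T` on `ℓ²` is of Schatten–von Neumann class `S_p`, `0 < p < ∞`:
`∑ s_n(T)^p < ∞`. -/
def MemSchatten (p : ℝ) (T : SeqHilbert →L[ℂ] SeqHilbert) : Prop :=
  Summable fun n : ℕ => singularNumber T n ^ p

/-- The matrix of a bounded operator in the standard orthonormal basis of `ℓ²`. -/
def operatorMatrix (T : SeqHilbert →L[ℂ] SeqHilbert) : Matrix ℕ ℕ ℂ :=
  Matrix.of fun j k => T (lp.single 2 k (1 : ℂ)) j

/-- `A ∈ 𝔐_p`: the matrix `A` is a Schur multiplier of `S_p`, i.e. the Schur (entrywise) product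
of `A` with the matrix of any operator of class `S_p` is the matrix of an operator of class
`S_p`. -/
def IsSchurMultiplier (p : ℝ) (A : Matrix ℕ ℕ ℂ) : Prop :=
  ∀ B : SeqHilbert →L[ℂ] SeqHilbert, MemSchatten p B →
    ∃ C : SeqHilbert →L[ℂ] SeqHilbert, MemSchatten p C ∧
      operatorMatrix C = A ⊙ operatorMatrix B

/-- The Hankel matrix `{c_{j+k}}_{j,k ≥ 0}` of a two-sided sequence of Fourier coefficients. -/
def hankelMatrix (c : ℤ → ℂ) : Matrix ℕ ℕ ℂ :=
  Matrix.of fun j k => c ((j : ℤ) + (k : ℤ))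

/-! ### Distributions on the unit circle

The circle `𝕋` is `ℝ / ℤ`, the point `x` standing for `z = exp (2 π i x)`; then `z ^ n` is
`fourier n x`, and `volume` is the normalized Lebesgue measure. -/

/-- The space `C^∞(𝕋)` of complex-valued test functions. -/
def circleTestFunctions : Submodule ℂ (UnitAddCircle → ℂ) where
  carrier := {f | ContDiff ℝ ∞ fun t : ℝ => f (t : UnitAddCircle)}
  add_mem' := fun {f g} (hf : ContDiff ℝ ∞ fun t : ℝ => f (t : UnitAddCircle))
    (hg : ContDiff ℝ ∞ fun t : ℝ => g (t : UnitAddCircle)) => hf.add hg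
  zero_mem' := (contDiff_const : ContDiff ℝ ∞ fun _ : ℝ => (0 : ℂ))
  smul_mem' := fun c f (hf : ContDiff ℝ ∞ fun t : ℝ => f (t : UnitAddCircle)) => hf.const_smul c

/-- A distribution on `𝕋`: a linear functional on `C^∞(𝕋)`, continuous with respect to the
topology of uniform convergence of all derivatives. -/
structure CircleDistribution where
  toLinearMap : circleTestFunctions →ₗ[ℂ] ℂ
  continuous' : ∃ (N : ℕ) (C : ℝ), ∀ (f : circleTestFunctions) (M : ℝ),
    (∀ k ≤ N, ∀ t : ℝ, ‖iteratedDeriv k (fun u : ℝ => f.1 (u : UnitAddCircle)) t‖ ≤ M) →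
      ‖toLinearMap f‖ ≤ C * M

/-- The monomial `z ^ n`, `n ∈ ℤ`, is a test function. -/
theorem fourier_mem_circleTestFunctions (n : ℤ) :
    (fun x : UnitAddCircle => fourier n x) ∈ circleTestFunctions := by
  change ContDiff ℝ ∞ fun t : ℝ => (fourier n (t : UnitAddCircle) : ℂ)
  simp only [fourier_coe_apply]
  have h : ContDiff ℝ ∞ (fun t : ℝ => (t : ℂ)) := Complex.ofRealCLM.contDiff
  exact ((contDiff_const.mul h).div_const _).cexp

/-- The Fourier coefficient `ψ̂(n) = ⟨ψ, z ^ (-n)⟩` of a distribution. -/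
def CircleDistribution.coeff (ψ : CircleDistribution) (n : ℤ) : ℂ :=
  ψ.toLinearMap ⟨fun x => fourier (-n) x, fourier_mem_circleTestFunctions (-n)⟩

/-- The Fourier coefficients of a function analytic in the unit disk: its Taylor coefficients
at `0`, extended by `0` to negative indices. -/
def taylorCoeff (ψ : ℂ → ℂ) (n : ℤ) : ℂ :=
  if 0 ≤ n then iteratedDeriv n.toNat ψ 0 / (n.toNat.factorial : ℂ) else 0

/-! ### Besov classes -/

/-- The functions `v` from which the kernels `V_n` are built: `v ∈ C^∞(ℝ)`, `v ≥ 0`,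
`supp v = [1/2, 2]` and `∑_{n ≥ 0} v(x / 2^n) = 1` for `x ≥ 1`. -/
structure IsBesovCutoff (v : ℝ → ℝ) : Prop where
  smooth : ContDiff ℝ ∞ v
  nonneg : ∀ x, 0 ≤ v x
  tsupport_eq : tsupport v = Set.Icc (1 / 2) 2
  hasSum_one : ∀ x : ℝ, 1 ≤ x → HasSum (fun n : ℕ => v (x / 2 ^ n)) 1

/-- The Fourier coefficient at `k` of the trigonometric polynomial `V_n`, `n ∈ ℤ`:
`V_n = ∑_{k ≥ 0} v(k / 2^n) z^k` for `n ≥ 1`, `V_0 = z⁻¹ + 1 + z`, and `V_n` is the complex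
conjugate of `V_{-n}` on `𝕋` for `n < 0`. -/
def besovKernelCoeff (v : ℝ → ℝ) (n k : ℤ) : ℝ :=
  if n = 0 then (if |k| ≤ 1 then 1 else 0)
  else if 0 < n then (if 0 ≤ k then v ((k : ℝ) / 2 ^ n.natAbs) else 0)
  else (if k ≤ 0 then v (-(k : ℝ) / 2 ^ n.natAbs) else 0)

/-- The convolution `ψ * V_n = ∑_k ψ̂(k) V̂_n(k) z^k` of a distribution with Fourier coefficients
`c` and `V_n`. The coefficients of `V_n` vanish for `|k| > 2^(|n|+1)`. -/
def besovBlock (v : ℝ → ℝ) (c : ℤ → ℂ) (n : ℤ) (x : UnitAddCircle) : ℂ :=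
  ∑ k ∈ Finset.Icc (-(2 : ℤ) ^ (n.natAbs + 1)) ((2 : ℤ) ^ (n.natAbs + 1)),
    c k * (besovKernelCoeff v n k : ℂ) * fourier k x

/-- The quantity `2^(|n| s) ‖ψ * V_n‖_{L^p(𝕋)}`, `n ∈ ℤ`. -/
def besovTerm (v : ℝ → ℝ) (s : ℝ) (p : ENNReal) (c : ℤ → ℂ) (n : ℤ) : ℝ :=
  (2 : ℝ) ^ ((n.natAbs : ℝ) * s) *
    (MeasureTheory.eLpNorm (besovBlock v c n) p MeasureTheory.volume).toReal

/-- The distribution `ψ` on `𝕋` is of Besov class `B^s_{pq}`, `0 < p, q ≤ ∞`: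
the sequence `{2^(|n| s) ‖ψ * V_n‖_{L^p}}_{n ∈ ℤ}` is in `ℓ^q(ℤ)`. -/
def MemBesov (v : ℝ → ℝ) (s : ℝ) (p q : ENNReal) (ψ : CircleDistribution) : Prop :=
  Memℓp (fun n : ℤ => besovTerm v s p ψ.coeff n) q

/-- `ψ ∈ (B^s_{pq})_+`: the function `ψ` is analytic in the unit disk and the sequence
`{2^(n s) ‖ψ * V_n‖_{L^p}}_{n ≥ 0}` is in `ℓ^q`. -/
def MemBesovPlus (v : ℝ → ℝ) (s : ℝ) (p q : ENNReal) (ψ : ℂ → ℂ) : Prop :=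
  AnalyticOnNhd ℂ ψ (Metric.ball 0 1) ∧
    Memℓp (fun n : ℕ => besovTerm v s p (taylorCoeff ψ) (n : ℤ)) q

/-! ### Exponents -/

/-- The number `1 / p_#`, where `p_# = p / (1 - p)` for `0 < p < 1` and `p_# = ∞` for `p = 1`. -/
def invSharp (p : ℝ) : ℝ := (1 - p) / p

/-- The exponent `p_♭ = 2p / (2 - p)`, for `p < 2`. -/
def flatExp (p : ℝ) : ℝ := 2 * p / (2 - p)

end

/-!
A matrix is a Schur multiplier of `S_p`, `p ≤ 1`, as soon as it acts boundedly on operators of rank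
one, because `‖∑ Tᵢ‖^p ≤ C ∑ ‖Tᵢ‖^p` in `S_p` (`exists_schattenSum_le_tsum`) and every operator of
class `S_p` is a sum of rank-one operators with `p`-summable norms (`exists_atomic_decomposition`).
The decomposition takes differences of near-best approximations of rank `2^k - 1` and expands them
in orthonormal bases of their ranges. The converse estimate
(`exists_schattenSum_le_of_hasSum_rankOne`) holds for `p = 1` by splitting off one rank-one
compression after another: if `e` and `f` nearly realize the norm of `T = ∑ xᵢ ⊗ yᵢ`, compressing
to their orthogonal complements lowers `∑ ‖xᵢ‖ ‖yᵢ‖` by at least `‖T‖ / 2`. For `p < 1` it follows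
from comparing the truncated sums `∑ min(t, ·)` for all dyadic `t`.

Let `Γ` be the Hankel matrix of a trigonometric polynomial `f` of degree `K`, and let `x`, `y` be
supported on `[0, K)`. Fourier inversion on a rotated grid of `4K` points writes the Schur product
of `Γ` with `x ⊗ y` as a sum of `4K` rank-one operators, and for a suitable rotation the `ℓ^r` sum
of their norms is controlled by `K^(1/r - 1) ‖f‖_{L^r} ‖x‖ ‖y‖`, simply because the average over all
rotations is (`exists_sum_grid_le`). If `x` or `y` is supported on `R` indices, the operator has
rank at most `R`, and Hölder's inequality turns the `S_r` bound into an `S_p` bound with the factor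
`R^(1/p - 1/r)` (`exists_hankel_block`).

Now take `f = ψ * V_n`. The nonzero entries of its Hankel matrix lie at pairs `(j, k)` whose larger
index is comparable to `2^n`, so each block sees one of the two vectors only through a dyadic band.
With `r = p`, Hölder's inequality with the exponents `1 / p = 1 / p_♭ + 1 / 2` sums the blocks
(`isSchurMultiplier_of_tsum_flatExp`). With `r > p` and the smaller index comparable to `2^m`, the
rank bound gives a factor decaying geometrically in `n - m`; both vectors then contribute a square
summable factor, and `1 / p = 1 / p_# + 1` suffices (`isSchurMultiplier_of_tsum_sharpExp`), where
`r_♭ ≤ p_#` if `r ≤ p_♭`. The class in the last assertion is contained in the one before it, since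
`p ≤ p_♭` and the circle has measure one.
-/

open scoped ENNReal Topology
open InnerProductSpace

/-! ### Singular numbers -/

theorem singularNumber_le (T K : SeqHilbert →L[ℂ] SeqHilbert) {n : ℕ}
    (hK : LinearMap.rank (K : SeqHilbert →ₗ[ℂ] SeqHilbert) ≤ (n : Cardinal)) :
    singularNumber T n ≤ ‖T - K‖ :=
  csInf_le ⟨0, by rintro d ⟨K, -, rfl⟩; exact norm_nonneg _⟩ ⟨K, hK, rfl⟩

theorem singularNumber_nonneg (T : SeqHilbert →L[ℂ] SeqHilbert) (n : ℕ) :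
    0 ≤ singularNumber T n :=
  Real.sInf_nonneg (by rintro d ⟨K, -, rfl⟩; exact norm_nonneg _)

theorem exists_rank_le_norm_sub_lt (T : SeqHilbert →L[ℂ] SeqHilbert) (n : ℕ) {ε : ℝ}
    (hε : 0 < ε) : ∃ K : SeqHilbert →L[ℂ] SeqHilbert,
      LinearMap.rank (K : SeqHilbert →ₗ[ℂ] SeqHilbert) ≤ (n : Cardinal) ∧
        ‖T - K‖ < singularNumber T n + ε := by
  obtain ⟨d, ⟨K, hK, rfl⟩, hd⟩ := Real.lt_sInf_add_pos
    (s := {d : ℝ | ∃ K : SeqHilbert →L[ℂ] SeqHilbert,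
      LinearMap.rank (K : SeqHilbert →ₗ[ℂ] SeqHilbert) ≤ (n : Cardinal) ∧ d = ‖T - K‖})
    ⟨_, 0, by simp, rfl⟩ hε
  exact ⟨K, hK, hd⟩

theorem singularNumber_antitone (T : SeqHilbert →L[ℂ] SeqHilbert) :
    Antitone (singularNumber T) := by
  intro m n hmn
  refine le_of_forall_pos_le_add fun ε hε => ?_
  obtain ⟨K, hK, h⟩ := exists_rank_le_norm_sub_lt T m hε
  exact (singularNumber_le T K (hK.trans (by exact_mod_cast hmn))).trans h.le

theorem singularNumber_zero_right (T : SeqHilbert →L[ℂ] SeqHilbert) :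
    singularNumber T 0 = ‖T‖ := by
  refine le_antisymm (by simpa using singularNumber_le T 0 (n := 0) (by simp)) ?_
  refine le_of_forall_pos_le_add fun ε hε => ?_
  obtain ⟨K, hK, h⟩ := exists_rank_le_norm_sub_lt T 0 hε
  have hK0 : K = 0 := by
    have h0 : LinearMap.rank (K : SeqHilbert →ₗ[ℂ] SeqHilbert) = 0 := by simpa using hK
    rw [LinearMap.rank, Submodule.rank_eq_zero, LinearMap.range_eq_bot] at h0
    ext1 x
    exact congrArg (fun f : SeqHilbert →ₗ[ℂ] SeqHilbert => f x) h0
  simpa [hK0] using h.le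

theorem singularNumber_add_le (S T : SeqHilbert →L[ℂ] SeqHilbert) (m n : ℕ) :
    singularNumber (S + T) (m + n) ≤ singularNumber S m + singularNumber T n := by
  refine le_of_forall_pos_le_add fun ε hε => ?_
  obtain ⟨K, hK, h⟩ := exists_rank_le_norm_sub_lt S m (half_pos hε)
  obtain ⟨L, hL, h'⟩ := exists_rank_le_norm_sub_lt T n (half_pos hε)
  have hr : LinearMap.rank ((K + L : SeqHilbert →L[ℂ] SeqHilbert) : SeqHilbert →ₗ[ℂ] SeqHilbert)
      ≤ ((m + n : ℕ) : Cardinal) := by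
    rw [ContinuousLinearMap.toLinearMap_add]
    push_cast
    exact (LinearMap.rank_add_le _ _).trans (add_le_add hK hL)
  refine (singularNumber_le (S + T) (K + L) hr).trans ?_
  have : S + T - (K + L) = (S - K) + (T - L) := by abel
  rw [this]
  refine (norm_add_le _ _).trans ?_
  linarith

theorem singularNumber_eq_zero_of_rank_le (T : SeqHilbert →L[ℂ] SeqHilbert) {n : ℕ}
    (hT : LinearMap.rank (T : SeqHilbert →ₗ[ℂ] SeqHilbert) ≤ (n : Cardinal)) :
    singularNumber T n = 0 :=
  le_antisymm (by simpa using singularNumber_le T T hT) (singularNumber_nonneg T n)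

theorem rank_sum_rankOne_le {ι : Type} (s : Finset ι) (x y : ι → SeqHilbert) :
    LinearMap.rank ((∑ i ∈ s, rankOne ℂ (x i) (y i) : SeqHilbert →L[ℂ] SeqHilbert) :
      SeqHilbert →ₗ[ℂ] SeqHilbert) ≤ (s.card : Cardinal) := by
  classical
  induction s using Finset.induction_on with
  | empty => simp
  | insert i s hi ih =>
    rw [Finset.sum_insert hi, ContinuousLinearMap.toLinearMap_add, Finset.card_insert_of_notMem hi,
      add_comm, Nat.cast_succ]
    refine (LinearMap.rank_add_le _ _).trans (add_le_add ih ?_)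
    refine (Submodule.rank_mono (t := Submodule.span ℂ {x i}) ?_).trans
      (by simpa using rank_span_le (R := ℂ) ({x i} : Set SeqHilbert))
    rintro _ ⟨z, rfl⟩
    exact Submodule.smul_mem _ _ (Submodule.mem_span_singleton_self _)

/-- The singular number `s_n(T)` as an extended nonnegative real; sums of powers of these numbers
need no summability side conditions. -/
noncomputable def singularENumber (T : SeqHilbert →L[ℂ] SeqHilbert) (n : ℕ) : ℝ≥0∞ :=
  ENNReal.ofReal (singularNumber T n)

theorem singularENumber_antitone (T : SeqHilbert →L[ℂ] SeqHilbert) :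
    Antitone (singularENumber T) :=
  fun _ _ h => ENNReal.ofReal_le_ofReal (singularNumber_antitone T h)

theorem singularENumber_zero_right (T : SeqHilbert →L[ℂ] SeqHilbert) :
    singularENumber T 0 = ‖T‖ₑ := by
  rw [singularENumber, singularNumber_zero_right, ofReal_norm]

theorem singularENumber_ne_top (T : SeqHilbert →L[ℂ] SeqHilbert) (n : ℕ) :
    singularENumber T n ≠ ⊤ := ENNReal.ofReal_ne_top

theorem singularENumber_add_le (S T : SeqHilbert →L[ℂ] SeqHilbert) (m n : ℕ) :
    singularENumber (S + T) (m + n) ≤ singularENumber S m + singularENumber T n := by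
  rw [singularENumber, singularENumber, singularENumber,
    ← ENNReal.ofReal_add (singularNumber_nonneg _ _) (singularNumber_nonneg _ _)]
  exact ENNReal.ofReal_le_ofReal (singularNumber_add_le S T m n)

theorem singularENumber_eq_zero_of_rank_le (T : SeqHilbert →L[ℂ] SeqHilbert) {n : ℕ}
    (hT : LinearMap.rank (T : SeqHilbert →ₗ[ℂ] SeqHilbert) ≤ (n : Cardinal)) :
    singularENumber T n = 0 := by
  rw [singularENumber, singularNumber_eq_zero_of_rank_le T hT, ENNReal.ofReal_zero]

/-- The sum `∑ s_n(T)^p`, the `p`-th power of the quasinorm of `S_p`, with values in `[0, ∞]`. -/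
noncomputable def schattenSum (p : ℝ) (T : SeqHilbert →L[ℂ] SeqHilbert) : ℝ≥0∞ :=
  ∑' n, singularENumber T n ^ p

theorem memSchatten_iff {p : ℝ} (hp : 0 < p) (T : SeqHilbert →L[ℂ] SeqHilbert) :
    MemSchatten p T ↔ schattenSum p T ≠ ⊤ := by
  have h : ∀ n, singularENumber T n ^ p = ENNReal.ofReal (singularNumber T n ^ p) := fun n =>
    ENNReal.ofReal_rpow_of_nonneg (singularNumber_nonneg T n) hp.le
  simp only [MemSchatten, schattenSum, h]
  refine ⟨fun hs => hs.tsum_ofReal_ne_top, fun hs => ?_⟩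
  have := ENNReal.summable_toReal hs
  refine this.congr fun n => ?_
  rw [ENNReal.toReal_ofReal (Real.rpow_nonneg (singularNumber_nonneg T n) p)]

theorem enorm_rpow_le_schattenSum (p : ℝ) (T : SeqHilbert →L[ℂ] SeqHilbert) :
    ‖T‖ₑ ^ p ≤ schattenSum p T := by
  rw [← singularENumber_zero_right]
  exact ENNReal.le_tsum 0

theorem schattenSum_zero {p : ℝ} (hp : 0 < p) : schattenSum p 0 = 0 := by
  have : ∀ n, singularENumber 0 n = 0 := fun n =>
    singularENumber_eq_zero_of_rank_le 0 (by simp)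
  simp [schattenSum, this, hp]

/-- Hölder's inequality for the finitely many nonzero singular numbers of an operator of rank at
most `R`. -/
theorem schattenSum_le_of_rank_le {p r : ℝ} (hp : 0 < p) (hpr : p ≤ r)
    (T : SeqHilbert →L[ℂ] SeqHilbert) {R : ℕ}
    (hT : LinearMap.rank (T : SeqHilbert →ₗ[ℂ] SeqHilbert) ≤ (R : Cardinal)) :
    schattenSum p T ≤ (R : ℝ≥0∞) ^ (1 - p / r) * schattenSum r T ^ (p / r) := by
  have hr : 0 < r := hp.trans_le hpr
  have hs : ∀ n, R ≤ n → singularENumber T n = 0 := fun n hn =>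
    le_antisymm ((singularENumber_antitone T hn).trans
      (singularENumber_eq_zero_of_rank_le T hT).le) zero_le
  have h1 : schattenSum p T = ∑ n ∈ Finset.range R, singularENumber T n ^ p :=
    tsum_eq_sum fun n hn => by
      rw [hs n (by simpa using hn), ENNReal.zero_rpow_of_pos hp]
  have h3 := ENNReal.lintegral_mul_norm_pow_le
    (μ := MeasureTheory.Measure.count (α := ℕ).restrict (Finset.range R : Set ℕ))
    (f := fun _ => 1) (g := fun n => singularENumber T n ^ r)
    (measurable_of_countable _).aemeasurable (measurable_of_countable _).aemeasurable
    (p := 1 - p / r) (q := p / r) (by rw [sub_nonneg]; exact (div_le_one hr).2 hpr)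
    (by positivity) (by ring)
  have hsum : ∀ f : ℕ → ℝ≥0∞, ∫⁻ n, f n ∂(MeasureTheory.Measure.count (α := ℕ).restrict
      (Finset.range R : Set ℕ)) = ∑ n ∈ Finset.range R, f n := fun f => by
    rw [MeasureTheory.lintegral_finset]
    simp
  simp only [hsum, ENNReal.one_rpow, one_mul, ← ENNReal.rpow_mul, mul_div_cancel₀ p hr.ne',
    Finset.sum_const, Finset.card_range, nsmul_eq_mul, mul_one] at h3
  rw [h1]
  refine h3.trans ?_
  gcongr
  exact ENNReal.sum_le_tsum _

/-! ### The trace norm dominates the sum of singular numbers -/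

/-- The map `x ↦ x - ⟪e, x⟫ e`; for a unit vector `e` it is the projection onto the orthogonal
complement of `e`. -/
noncomputable def deflation (e : SeqHilbert) : SeqHilbert →L[ℂ] SeqHilbert :=
  ContinuousLinearMap.id ℂ SeqHilbert - rankOne ℂ e e

theorem deflation_apply (e x : SeqHilbert) : deflation e x = x - inner ℂ e x • e := rfl

theorem inner_deflation_right (e x y : SeqHilbert) :
    inner ℂ x (deflation e y) = inner ℂ (deflation e x) y := by
  simp only [deflation_apply, inner_sub_left, inner_sub_right, inner_smul_left, inner_smul_right,
    inner_conj_symm]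
  ring

theorem norm_deflation_sq_add_le {e : SeqHilbert} (he : ‖e‖ ≤ 1) (x : SeqHilbert) :
    ‖deflation e x‖ ^ 2 + ‖inner ℂ e x‖ ^ 2 ≤ ‖x‖ ^ 2 := by
  rw [deflation_apply, @norm_sub_sq ℂ, inner_smul_right, norm_smul, mul_pow]
  have h : RCLike.re (inner ℂ e x * inner ℂ x e) = ‖inner ℂ e x‖ ^ 2 := by
    rw [← inner_conj_symm x e, RCLike.mul_conj]
    norm_cast
  rw [h]
  have : ‖inner ℂ e x‖ ^ 2 * ‖e‖ ^ 2 ≤ ‖inner ℂ e x‖ ^ 2 * 1 := by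
    gcongr
    exact pow_le_one₀ (norm_nonneg _) he
  linarith

theorem deflation_comp_rankOne_comp (e f x y : SeqHilbert) :
    deflation f ∘L rankOne ℂ x y ∘L deflation e = rankOne ℂ (deflation f x) (deflation e y) := by
  ext1 z
  simp only [ContinuousLinearMap.comp_apply, rankOne_apply, map_smul, inner_deflation_right]

theorem norm_deflation_mul_add_le {e f : SeqHilbert} (he : ‖e‖ ≤ 1) (hf : ‖f‖ ≤ 1)
    (x y : SeqHilbert) :
    ‖deflation f x‖ * ‖deflation e y‖ + ‖inner ℂ f x‖ * ‖inner ℂ e y‖ ≤ ‖x‖ * ‖y‖ := by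
  have hx := norm_deflation_sq_add_le hf x
  have hy := norm_deflation_sq_add_le he y
  refine abs_le_of_sq_le_sq' ?_ (by positivity) |>.2
  calc _ ≤ (‖deflation f x‖ ^ 2 + ‖inner ℂ f x‖ ^ 2) *
        (‖deflation e y‖ ^ 2 + ‖inner ℂ e y‖ ^ 2) := by
        nlinarith [sq_nonneg (‖deflation f x‖ * ‖inner ℂ e y‖ - ‖inner ℂ f x‖ * ‖deflation e y‖)]
    _ ≤ ‖x‖ ^ 2 * ‖y‖ ^ 2 := by gcongr
    _ = _ := by ring

/-- Compressing by two deflations changes an operator by one of rank at most two. -/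
theorem singularENumber_add_two_le (T : SeqHilbert →L[ℂ] SeqHilbert) (e f : SeqHilbert) (n : ℕ) :
    singularENumber T (n + 2) ≤ singularENumber (deflation f ∘L T ∘L deflation e) n := by
  set D := rankOne ℂ f (ContinuousLinearMap.adjoint T f) + rankOne ℂ (deflation f (T e)) e with hD
  have hT : T = deflation f ∘L T ∘L deflation e + D := by
    ext1 z
    simp only [hD, add_apply, ContinuousLinearMap.comp_apply, rankOne_apply,
      deflation_apply, map_sub, map_smul, ContinuousLinearMap.adjoint_inner_left, sub_apply,
      smul_apply]
    module
  have hr : LinearMap.rank (D : SeqHilbert →ₗ[ℂ] SeqHilbert) ≤ ((2 : ℕ) : Cardinal) := by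
    have := rank_sum_rankOne_le (Finset.univ : Finset (Fin 2))
      ![f, deflation f (T e)] ![ContinuousLinearMap.adjoint T f, e]
    simpa [Fin.sum_univ_two, hD] using this
  conv_lhs => rw [hT]
  refine (singularENumber_add_le _ _ n 2).trans ?_
  rw [singularENumber_eq_zero_of_rank_le D hr, add_zero]

theorem exists_half_norm_le (T : SeqHilbert →L[ℂ] SeqHilbert) :
    ∃ e : SeqHilbert, ‖e‖ ≤ 1 ∧ ‖T‖ ≤ 2 * ‖T e‖ := by
  rcases eq_or_ne T 0 with rfl | hT
  · exact ⟨0, by simp, by simp⟩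
  · have h : ‖T‖ / 2 < ‖T‖ := half_lt_self (norm_pos_iff.2 hT)
    obtain ⟨e, he, h'⟩ := ContinuousLinearMap.exists_lt_apply_of_lt_opNorm T h
    exact ⟨e, he.le, by linarith⟩

theorem hasSum_inner_apply {ι : Type} {S : ι → SeqHilbert →L[ℂ] SeqHilbert}
    {T : SeqHilbert →L[ℂ] SeqHilbert} (h : HasSum S T) (e f : SeqHilbert) :
    HasSum (fun i => inner ℂ f (S i e)) (inner ℂ f (T e)) :=
  h.mapL ((innerSL ℂ f) ∘L (ContinuousLinearMap.apply ℂ SeqHilbert e))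

theorem enorm_inner_le_tsum {ι : Type} {T : SeqHilbert →L[ℂ] SeqHilbert} {x y : ι → SeqHilbert}
    (h : HasSum (fun i => rankOne ℂ (x i) (y i)) T) (e f : SeqHilbert) :
    ‖inner ℂ f (T e)‖ₑ ≤ ∑' i, ‖inner ℂ f (x i)‖ₑ * ‖inner ℂ e (y i)‖ₑ := by
  rw [← (hasSum_inner_apply h e f).tsum_eq]
  refine enorm_tsum_le_tsum_enorm.trans (ENNReal.tsum_le_tsum fun i => ?_)
  rw [rankOne_apply, inner_smul_right, enorm_mul, mul_comm]
  gcongr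
  rw [← inner_conj_symm, RCLike.enorm_conj]

theorem sum_singularENumber_two_mul_le {ι : Type} (N : ℕ) :
    ∀ {T : SeqHilbert →L[ℂ] SeqHilbert} {x y : ι → SeqHilbert},
      HasSum (fun i => rankOne ℂ (x i) (y i)) T →
      ∑ k ∈ Finset.range N, singularENumber T (2 * k) ≤ 2 * ∑' i, ‖x i‖ₑ * ‖y i‖ₑ := by
  induction N with
  | zero => simp
  | succ N ih =>
    intro T x y h
    obtain ⟨e, he, hTe⟩ := exists_half_norm_le T
    -- If `T e = 0`, then `f = 0`, and the inequalities below are still valid.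
    set f : SeqHilbert := ((‖T e‖⁻¹ : ℝ) : ℂ) • T e with hf_def
    have hf : ‖f‖ ≤ 1 := by
      rw [hf_def, norm_smul, Complex.norm_real, norm_inv, norm_norm]
      exact inv_mul_le_one
    have hfT : ‖inner ℂ f (T e)‖ₑ = ‖T e‖ₑ := by
      rw [← enorm_norm, ← enorm_norm (T e)]
      congr 1
      rw [hf_def, inner_smul_left, norm_mul, inner_self_eq_norm_sq_to_K]
      simp only [Complex.conj_ofReal, Complex.norm_real, norm_inv, norm_norm, norm_pow,
        Complex.coe_algebraMap]
      rcases eq_or_ne ‖T e‖ 0 with h0 | h0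
      · simp [h0]
      · field_simp
    have h' : HasSum (fun i => rankOne ℂ (deflation f (x i)) (deflation e (y i)))
        (deflation f ∘L T ∘L deflation e) := by
      simp only [← deflation_comp_rankOne_comp]
      exact h.mapL ((ContinuousLinearMap.compL ℂ SeqHilbert SeqHilbert SeqHilbert (deflation f)) ∘L
        ((ContinuousLinearMap.compL ℂ SeqHilbert SeqHilbert SeqHilbert).flip (deflation e)))
    have h0 : singularENumber T (2 * 0) ≤ 2 * ∑' i, ‖inner ℂ f (x i)‖ₑ * ‖inner ℂ e (y i)‖ₑ := by
      rw [mul_zero, singularENumber_zero_right]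
      refine le_trans ?_ (mul_le_mul_right (enorm_inner_le_tsum h e f) _)
      rw [hfT, ← ofReal_norm, ← ofReal_norm]
      refine (ENNReal.ofReal_le_ofReal hTe).trans_eq ?_
      rw [ENNReal.ofReal_mul zero_le_two, ENNReal.ofReal_ofNat]
    rw [Finset.sum_range_succ']
    calc _ ≤ 2 * ∑' i, ‖deflation f (x i)‖ₑ * ‖deflation e (y i)‖ₑ +
          2 * ∑' i, ‖inner ℂ f (x i)‖ₑ * ‖inner ℂ e (y i)‖ₑ := by
          refine add_le_add ((Finset.sum_le_sum fun k _ => ?_).trans (ih h')) h0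
          exact singularENumber_add_two_le T e f (2 * k)
      _ ≤ _ := by
          rw [← mul_add, ← ENNReal.tsum_add]
          gcongr with i
          simp only [← ofReal_norm]
          rw [← ENNReal.ofReal_mul (norm_nonneg _), ← ENNReal.ofReal_mul (norm_nonneg _),
            ← ENNReal.ofReal_mul (norm_nonneg _),
            ← ENNReal.ofReal_add (by positivity) (by positivity)]
          exact ENNReal.ofReal_le_ofReal (norm_deflation_mul_add_le he hf _ _)

theorem tsum_singularENumber_le {ι : Type} {T : SeqHilbert →L[ℂ] SeqHilbert}
    {x y : ι → SeqHilbert} (h : HasSum (fun i => rankOne ℂ (x i) (y i)) T) :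
    ∑' n, singularENumber T n ≤ 4 * ∑' i, ‖x i‖ₑ * ‖y i‖ₑ := by
  have h2 : ∑' k, singularENumber T (2 * k) ≤ 2 * ∑' i, ‖x i‖ₑ * ‖y i‖ₑ := by
    rw [ENNReal.tsum_eq_iSup_nat]
    exact iSup_le fun N => sum_singularENumber_two_mul_le N h
  rw [← tsum_even_add_odd ENNReal.summable ENNReal.summable]
  calc _ ≤ 2 * ∑' i, ‖x i‖ₑ * ‖y i‖ₑ + 2 * ∑' i, ‖x i‖ₑ * ‖y i‖ₑ := by
        refine add_le_add h2 ((ENNReal.tsum_le_tsum fun k => ?_).trans h2)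
        exact singularENumber_antitone T (Nat.le_succ _)
    _ = _ := by ring

/-! ### Sums of rank-one operators are of Schatten class -/

theorem card_mul_eq_tsum_ite {ι : Type} [DecidableEq ι] (F : Finset ι) (t : ℝ≥0∞) :
    (F.card : ℝ≥0∞) * t = ∑' i, if i ∈ F then t else 0 := by
  have h : ∀ i, i ∉ F → (if i ∈ F then t else 0) = 0 := fun i hi => if_neg hi
  rw [tsum_eq_sum h, Finset.sum_ite_mem, Finset.inter_self, Finset.sum_const, nsmul_eq_mul]

/-- The truncated sums `∑ min(t, ·)` play the role of a `K`-functional: operators of rank `N` are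
absorbed by the first `N` terms, and the remaining small summands are controlled by their trace
norms. -/
theorem tsum_min_singularENumber_le {ι : Type} {T : SeqHilbert →L[ℂ] SeqHilbert}
    {x y : ι → SeqHilbert} (h : HasSum (fun i => rankOne ℂ (x i) (y i)) T) {t : ℝ≥0∞}
    (ht : t ≠ 0) :
    ∑' n, min t (singularENumber T n) ≤ 4 * ∑' i, min t (‖x i‖ₑ * ‖y i‖ₑ) := by
  classical
  rcases eq_or_ne (∑' i, min t (‖x i‖ₑ * ‖y i‖ₑ)) ⊤ with htop | hfin
  · simp [htop]
  have hF := ENNReal.finite_const_le_of_tsum_ne_top hfin ht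
  obtain ⟨F, hmem⟩ : ∃ F : Finset ι, ∀ i, i ∈ F ↔ t ≤ ‖x i‖ₑ * ‖y i‖ₑ :=
    ⟨hF.toFinset, fun i => by simp⟩
  obtain ⟨T₁, hT₁⟩ : ∃ T₁ : SeqHilbert →L[ℂ] SeqHilbert, T₁ = ∑ i ∈ F, rankOne ℂ (x i) (y i) :=
    ⟨_, rfl⟩
  have h₁ : HasSum (fun i => if i ∈ F then rankOne ℂ (x i) (y i) else 0) T₁ := by
    have hs : T₁ = ∑ i ∈ F, if i ∈ F then rankOne ℂ (x i) (y i) else 0 := by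
      rw [hT₁]
      exact Finset.sum_congr rfl fun i hi => (if_pos hi).symm
    rw [hs]
    exact hasSum_sum_of_ne_finset_zero fun i hi => if_neg hi
  have h₂ : HasSum (fun i => rankOne ℂ (if i ∈ F then 0 else x i) (y i)) (T - T₁) := by
    refine (h.sub h₁).congr_fun ?_
    intro i
    by_cases hi : i ∈ F <;> simp [hi]
  have hshift : ∀ n, singularENumber T (n + F.card) ≤ singularENumber (T - T₁) n := fun n => by
    have := singularENumber_add_le (T - T₁) T₁ n F.card
    rwa [sub_add_cancel, singularENumber_eq_zero_of_rank_le T₁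
      (hT₁ ▸ rank_sum_rankOne_le F x y), add_zero] at this
  rw [← Summable.sum_add_tsum_nat_add' (f := fun n => min t (singularENumber T n)) (k := F.card)
    ENNReal.summable]
  calc _ ≤ (F.card : ℝ≥0∞) * t + ∑' n, singularENumber (T - T₁) n := by
        refine add_le_add ?_ (ENNReal.tsum_le_tsum fun n => (min_le_right _ _).trans (hshift n))
        refine (Finset.sum_le_sum fun n _ => min_le_left _ _).trans ?_
        simp
    _ ≤ 4 * ((F.card : ℝ≥0∞) * t) + 4 * ∑' i, ‖if i ∈ F then 0 else x i‖ₑ * ‖y i‖ₑ := by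
        refine add_le_add ?_ (tsum_singularENumber_le h₂)
        exact le_mul_of_one_le_left zero_le (by norm_num)
    _ ≤ _ := by
        rw [← mul_add, card_mul_eq_tsum_ite, ← ENNReal.tsum_add]
        gcongr with i
        by_cases hi : i ∈ F
        · simp [hi, (hmem i).1 hi]
        · simp only [hi, if_false, zero_add]
          exact le_min (not_le.1 fun hc => hi ((hmem i).2 hc)).le le_rfl

/-- The dyadic substitute for the integral of `min(s, t) s ^ (p - 2)` in `s` over `(0, ∞)`, which
is comparable to `t ^ p`. -/
noncomputable def dyadicTruncation (p : ℝ) (t : ℝ≥0∞) : ℝ≥0∞ :=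
  ∑' l : ℤ, (2 : ℝ≥0∞) ^ ((l : ℝ) * (p - 1)) * min (2 ^ (l : ℝ)) t

theorem two_rpow_add (a b : ℝ) : (2 : ℝ≥0∞) ^ (a + b) = 2 ^ a * 2 ^ b :=
  ENNReal.rpow_add a b two_ne_zero ENNReal.ofNat_ne_top

theorem exists_dyadic_le {t : ℝ≥0∞} (h0 : t ≠ 0) (ht : t ≠ ⊤) :
    ∃ l : ℤ, (2 : ℝ≥0∞) ^ (l : ℝ) ≤ t ∧ t ≤ 2 ^ ((l : ℝ) + 1) := by
  obtain ⟨l, hl, hl'⟩ := ENNReal.exists_mem_Ico_zpow h0 ht (y := 2) (by norm_num) (by norm_num)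
  refine ⟨l, by rwa [ENNReal.rpow_intCast], ?_⟩
  have : ((l : ℝ) + 1) = ((l + 1 : ℤ) : ℝ) := by push_cast; ring
  rw [this, ENNReal.rpow_intCast]
  exact hl'.le

theorem rpow_le_dyadicTruncation {p : ℝ} (hp : 0 < p) {t : ℝ≥0∞} (ht : t ≠ ⊤) :
    t ^ p ≤ 2 ^ p * dyadicTruncation p t := by
  rcases eq_or_ne t 0 with rfl | h0
  · simp [hp]
  obtain ⟨l, hl, hl'⟩ := exists_dyadic_le h0 ht
  calc t ^ p ≤ (2 ^ ((l : ℝ) + 1)) ^ p := ENNReal.rpow_le_rpow hl' hp.le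
    _ = 2 ^ p * (2 ^ ((l : ℝ) * (p - 1)) * min (2 ^ (l : ℝ)) t) := by
        rw [min_eq_left hl, ← two_rpow_add, ← two_rpow_add, ← ENNReal.rpow_mul]
        congr 1
        ring
    _ ≤ _ := by
        gcongr
        exact ENNReal.le_tsum (f := fun l : ℤ =>
          (2 : ℝ≥0∞) ^ ((l : ℝ) * (p - 1)) * min (2 ^ (l : ℝ)) t) l

theorem tsum_two_rpow_neg_ne_top {a : ℝ} (ha : 0 < a) :
    ∑' m : ℕ, (2 : ℝ≥0∞) ^ (-(a * m)) ≠ ⊤ := by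
  have h : ∀ m : ℕ, (2 : ℝ≥0∞) ^ (-(a * m)) = (2 ^ (-a)) ^ m := fun m => by
    rw [← ENNReal.rpow_natCast, ← ENNReal.rpow_mul, neg_mul]
  simp only [h, ENNReal.tsum_geometric]
  rw [ENNReal.inv_ne_top]
  have : (2 : ℝ≥0∞) ^ (-a) < 1 := ENNReal.rpow_lt_one_of_one_lt_of_neg (by norm_num) (by linarith)
  exact (tsub_pos_of_lt this).ne'

theorem dyadicTruncation_le_rpow {p : ℝ} (hp : 0 < p) {t : ℝ≥0∞} (ht : t ≠ ⊤) :
    dyadicTruncation p t ≤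
      (2 * ∑' m : ℕ, (2 : ℝ≥0∞) ^ (-((1 - p) * m)) + ∑' m : ℕ, (2 : ℝ≥0∞) ^ (-(p * m))) *
        t ^ p := by
  rcases eq_or_ne t 0 with rfl | h0
  · simp [dyadicTruncation]
  obtain ⟨l, hl, hl'⟩ := exists_dyadic_le h0 ht
  have hlp : ((2 : ℝ≥0∞) ^ ((l : ℝ) * p)) ≤ t ^ p := by
    rw [ENNReal.rpow_mul]
    exact ENNReal.rpow_le_rpow hl hp.le
  rw [dyadicTruncation, ← (Equiv.addLeft l).tsum_eq,
    tsum_of_nat_of_neg_add_one ENNReal.summable ENNReal.summable, add_mul]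
  refine add_le_add ?_ ?_
  · rw [mul_assoc, ← ENNReal.tsum_mul_right, ← ENNReal.tsum_mul_left]
    refine ENNReal.tsum_le_tsum fun m => ?_
    calc _ ≤ (2 : ℝ≥0∞) ^ (((l + m : ℤ) : ℝ) * (p - 1)) * 2 ^ ((l : ℝ) + 1) := by
          simp only [Equiv.coe_addLeft]
          gcongr
          exact (min_le_right _ _).trans hl'
      _ = 2 ^ (1 : ℝ) * (2 ^ (-((1 - p) * m)) * 2 ^ ((l : ℝ) * p)) := by
          simp only [← two_rpow_add]
          congr 1
          push_cast
          ring
      _ ≤ _ := by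
          rw [ENNReal.rpow_one]
          gcongr
  · rw [← ENNReal.tsum_mul_right]
    refine ENNReal.tsum_le_tsum fun m => ?_
    calc _ ≤ (2 : ℝ≥0∞) ^ (((l + -(m + 1) : ℤ) : ℝ) * (p - 1)) *
            2 ^ ((l + -(m + 1) : ℤ) : ℝ) := by
          simp only [Equiv.coe_addLeft]
          gcongr
          exact min_le_left _ _
      _ = 2 ^ (-(p * m) - p) * 2 ^ ((l : ℝ) * p) := by
          simp only [← two_rpow_add]
          congr 1
          push_cast
          ring
      _ ≤ _ := by
          gcongr
          · norm_num
          · linarith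

/-- If `T = ∑ xᵢ ⊗ yᵢ`, then `‖T‖_{S_p}^p ≤ C_p ∑ ‖xᵢ‖^p ‖yᵢ‖^p`, for `0 < p ≤ 1`. -/
theorem exists_schattenSum_le_of_hasSum_rankOne {p : ℝ} (hp : 0 < p) (hp1 : p ≤ 1) :
    ∃ C : ℝ≥0∞, C ≠ ⊤ ∧ ∀ (ι : Type) (T : SeqHilbert →L[ℂ] SeqHilbert) (x y : ι → SeqHilbert),
      HasSum (fun i => rankOne ℂ (x i) (y i)) T →
        schattenSum p T ≤ C * ∑' i, (‖x i‖ₑ * ‖y i‖ₑ) ^ p := by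
  rcases hp1.eq_or_lt with rfl | hp1
  · exact ⟨4, by norm_num, fun ι T x y h => by
      simpa [schattenSum] using tsum_singularENumber_le h⟩
  refine ⟨2 ^ p * (4 * (2 * ∑' m : ℕ, (2 : ℝ≥0∞) ^ (-((1 - p) * m)) +
    ∑' m : ℕ, (2 : ℝ≥0∞) ^ (-(p * m)))), ?_, fun ι T x y h => ?_⟩
  · have h1 := tsum_two_rpow_neg_ne_top (a := 1 - p) (by linarith)
    have h2 := tsum_two_rpow_neg_ne_top hp
    finiteness
  · calc schattenSum p T ≤ ∑' n, 2 ^ p * dyadicTruncation p (singularENumber T n) :=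
          ENNReal.tsum_le_tsum fun n => rpow_le_dyadicTruncation hp (singularENumber_ne_top T n)
      _ = 2 ^ p * ∑' l : ℤ, (2 : ℝ≥0∞) ^ ((l : ℝ) * (p - 1)) *
            ∑' n, min (2 ^ (l : ℝ)) (singularENumber T n) := by
          simp only [dyadicTruncation]
          rw [ENNReal.tsum_mul_left, ENNReal.tsum_comm]
          simp only [ENNReal.tsum_mul_left]
      _ ≤ 2 ^ p * ∑' l : ℤ, (2 : ℝ≥0∞) ^ ((l : ℝ) * (p - 1)) *
            (4 * ∑' i, min (2 ^ (l : ℝ)) (‖x i‖ₑ * ‖y i‖ₑ)) := by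
          gcongr with l
          exact tsum_min_singularENumber_le h
            (ENNReal.rpow_pos (by norm_num) (by norm_num)).ne'
      _ = 2 ^ p * (4 * ∑' i, dyadicTruncation p (‖x i‖ₑ * ‖y i‖ₑ)) := by
          simp only [dyadicTruncation]
          rw [ENNReal.tsum_comm (α := ι)]
          simp only [ENNReal.tsum_mul_left, mul_left_comm _ (4 : ℝ≥0∞)]
      _ ≤ 2 ^ p * (4 * ∑' i, (2 * ∑' m : ℕ, (2 : ℝ≥0∞) ^ (-((1 - p) * m)) +
            ∑' m : ℕ, (2 : ℝ≥0∞) ^ (-(p * m))) * (‖x i‖ₑ * ‖y i‖ₑ) ^ p) := by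
          gcongr with i
          exact dyadicTruncation_le_rpow hp (by finiteness)
      _ = _ := by
          rw [ENNReal.tsum_mul_left]
          ring

/-! ### Atomic decompositions of operators of Schatten class -/

theorem tsum_le_rpow_mul_tsum_rpow {ι : Type} {p : ℝ} (hp : 0 < p) (hp1 : p ≤ 1) (a : ι → ℝ≥0∞) :
    ∑' i, a i ≤ ((∑' i, a i ^ p) ^ p⁻¹) ^ (1 - p) * ∑' i, a i ^ p := by
  rw [← ENNReal.tsum_mul_left]
  refine ENNReal.tsum_le_tsum fun i => ?_
  have h : a i ≤ (∑' i, a i ^ p) ^ p⁻¹ := by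
    rw [ENNReal.le_rpow_inv_iff hp]
    exact ENNReal.le_tsum (f := fun i => a i ^ p) i
  calc a i = a i ^ (1 - p) * a i ^ p := by
        rw [← ENNReal.rpow_add_of_nonneg _ _ (by linarith) hp.le, sub_add_cancel, ENNReal.rpow_one]
    _ ≤ _ := by
        gcongr

theorem summable_of_tsum_enorm_rpow_ne_top {ι E : Type} [NormedAddCommGroup E] [CompleteSpace E]
    {p : ℝ} (hp : 0 < p) (hp1 : p ≤ 1) {f : ι → E} (h : ∑' i, ‖f i‖ₑ ^ p ≠ ⊤) : Summable f := by
  refine Summable.of_norm (tsum_enorm_ne_top_iff_summable_norm.1 ?_)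
  refine ne_top_of_le_ne_top ?_ (tsum_le_rpow_mul_tsum_rpow hp hp1 _)
  have : 0 ≤ 1 - p := by linarith
  finiteness

/-- Expanding the values of a finite-rank operator in an orthonormal basis of its range writes it
as a sum of rank-one operators, none of larger norm. -/
theorem exists_eq_sum_rankOne (D : SeqHilbert →L[ℂ] SeqHilbert) {N : ℕ}
    (hD : LinearMap.rank (D : SeqHilbert →ₗ[ℂ] SeqHilbert) ≤ (N : Cardinal)) :
    ∃ m ≤ N, ∃ x y : Fin m → SeqHilbert, D = ∑ i, rankOne ℂ (x i) (y i) ∧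
      ∀ i, ‖x i‖ₑ * ‖y i‖ₑ ≤ ‖D‖ₑ := by
  set V := LinearMap.range (D : SeqHilbert →ₗ[ℂ] SeqHilbert)
  have hfin : FiniteDimensional ℂ V :=
    Module.rank_lt_aleph0_iff.1 (hD.trans_lt Cardinal.natCast_lt_aleph0)
  have hle : Module.finrank ℂ V ≤ N := by
    have : (Module.finrank ℂ V : Cardinal) ≤ N := by rw [Module.finrank_eq_rank]; exact hD
    exact_mod_cast this
  set b := stdOrthonormalBasis ℂ V with hb
  refine ⟨_, hle, fun i => (b i : SeqHilbert),
    fun i => ContinuousLinearMap.adjoint D (b i : SeqHilbert), ?_, fun i => ?_⟩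
  · ext1 z
    have h := congrArg (fun w : V => (w : SeqHilbert)) (b.sum_repr' ⟨D z, ⟨z, rfl⟩⟩)
    simp only [Submodule.coe_sum, Submodule.coe_smul, Submodule.coe_inner] at h
    rw [sum_apply]
    simp only [rankOne_apply, ContinuousLinearMap.adjoint_inner_left]
    exact h.symm
  · have h1 : ‖(b i : SeqHilbert)‖ = 1 := b.norm_eq_one i
    rw [← ofReal_norm, ← ofReal_norm, ← ofReal_norm, ← ENNReal.ofReal_mul (norm_nonneg _)]
    refine ENNReal.ofReal_le_ofReal ?_
    rw [h1, one_mul]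
    calc _ ≤ ‖ContinuousLinearMap.adjoint D‖ * ‖(b i : SeqHilbert)‖ :=
          ContinuousLinearMap.le_opNorm _ _
      _ = ‖D‖ := by rw [h1, mul_one, LinearIsometryEquiv.norm_map]

theorem tsum_two_pow_mul_singularENumber_le {p : ℝ} (hp : 0 < p)
    (T : SeqHilbert →L[ℂ] SeqHilbert) :
    ∑' k : ℕ, 2 ^ k * singularENumber T (2 ^ k - 1) ^ p ≤ 5 * schattenSum p T := by
  have h := ENNReal.tsum_condensed_le (f := fun n => singularENumber T (n - 1) ^ p)
    (fun m n _ hmn => ENNReal.rpow_le_rpow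
      (singularENumber_antitone T (Nat.sub_le_sub_right hmn 1)) hp.le)
  refine h.trans ?_
  rw [tsum_eq_zero_add' ENNReal.summable]
  have h0 : singularENumber T 0 ^ p ≤ schattenSum p T := by
    rw [singularENumber_zero_right]
    exact enorm_rpow_le_schattenSum p T
  simp only [Nat.sub_self, Nat.zero_sub, Nat.add_sub_cancel]
  change _ + 2 * (_ + schattenSum p T) ≤ _
  calc _ ≤ schattenSum p T + 2 * (schattenSum p T + schattenSum p T) := by gcongr
    _ = _ := by ring

theorem tsum_two_pow_mul_quarter_rpow {p : ℝ} (hp : 0 < p) (c : ℝ≥0∞) :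
    ∑' k : ℕ, 2 ^ k * (c * 4 ^ (-((k : ℝ) / p))) ^ p = 2 * c ^ p := by
  have h : ∀ k : ℕ, (2 : ℝ≥0∞) ^ k * (c * 4 ^ (-((k : ℝ) / p))) ^ p = c ^ p * 2⁻¹ ^ k := by
    intro k
    have h4 : (4 : ℝ≥0∞) = 2 ^ (2 : ℝ) := by norm_num
    rw [ENNReal.mul_rpow_of_nonneg _ _ hp.le, ← ENNReal.rpow_mul, h4, ← ENNReal.rpow_mul,
      mul_left_comm, ← ENNReal.rpow_natCast, ← ENNReal.rpow_natCast,
      ← ENNReal.rpow_neg_one 2, ← ENNReal.rpow_mul, ← two_rpow_add]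
    congr 2
    field_simp
    ring
  simp only [h, ENNReal.tsum_mul_left, ENNReal.tsum_geometric, ENNReal.one_sub_inv_two, inv_inv]
  rw [mul_comm]

theorem exists_atomic_decomposition {p : ℝ} (hp : 0 < p) (hp1 : p ≤ 1) :
    ∃ C : ℝ≥0∞, C ≠ ⊤ ∧ ∀ T : SeqHilbert →L[ℂ] SeqHilbert, schattenSum p T ≠ ⊤ →
      ∃ (ι : Type) (x y : ι → SeqHilbert), HasSum (fun i => rankOne ℂ (x i) (y i)) T ∧
        ∑' i, (‖x i‖ₑ * ‖y i‖ₑ) ^ p ≤ C * schattenSum p T := by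
  refine ⟨4 * 2 ^ p * 7, by finiteness, fun T hT => ?_⟩
  rcases eq_or_ne T 0 with rfl | hT0
  · exact ⟨Empty, Empty.elim, Empty.elim, hasSum_empty, by simp⟩
  -- The errors `ε k` are chosen so that `∑ 2 ^ k * ε k ^ p` is comparable to `‖T‖ ^ p`.
  set ε : ℕ → ℝ := fun k => ‖T‖ * 4 ^ (-((k : ℝ) / p)) with hε
  have hεpos : ∀ k, 0 < ε k := fun k => mul_pos (norm_pos_iff.2 hT0) (by positivity)
  have hεanti : ∀ k, ε (k + 1) ≤ ε k := fun k => by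
    simp only [hε]
    gcongr
    · norm_num
    · exact Nat.le_succ k
  choose K hKrank hK using fun k => exists_rank_le_norm_sub_lt T (2 ^ k - 1) (hεpos k)
  set δ : ℕ → ℝ≥0∞ := fun k => singularENumber T (2 ^ k - 1) + ENNReal.ofReal (ε k) with hδ
  have hKδ : ∀ k, ‖T - K k‖ₑ ≤ δ k := fun k => by
    rw [hδ, ← ofReal_norm]
    simp only [singularENumber]
    rw [← ENNReal.ofReal_add (singularNumber_nonneg _ _) (hεpos k).le]
    exact ENNReal.ofReal_le_ofReal (hK k).le
  have hδanti : ∀ k, δ (k + 1) ≤ δ k := fun k => by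
    refine add_le_add (singularENumber_antitone T ?_) (ENNReal.ofReal_le_ofReal (hεanti k))
    exact Nat.sub_le_sub_right (Nat.pow_le_pow_right two_pos (Nat.le_succ k)) 1
  have hδsum : ∑' k : ℕ, 2 ^ k * δ k ^ p ≤ 7 * schattenSum p T := by
    calc _ ≤ ∑' k : ℕ, (2 ^ k * singularENumber T (2 ^ k - 1) ^ p +
          2 ^ k * (‖T‖ₑ * 4 ^ (-((k : ℝ) / p))) ^ p) := by
          gcongr with k
          rw [← mul_add]
          gcongr
          refine (ENNReal.rpow_add_le_add_rpow _ _ hp.le hp1).trans_eq ?_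
          rw [hε, ENNReal.ofReal_mul (norm_nonneg _), ofReal_norm,
            ← ENNReal.ofReal_rpow_of_pos (by norm_num), ENNReal.ofReal_ofNat]
      _ ≤ 5 * schattenSum p T + 2 * schattenSum p T := by
          rw [ENNReal.tsum_add, tsum_two_pow_mul_quarter_rpow hp]
          gcongr
          · exact tsum_two_pow_mul_singularENumber_le hp T
          · exact enorm_rpow_le_schattenSum p T
      _ = _ := by ring
  have hK0 : K 0 = 0 := by
    obtain ⟨m, hm, x, y, h, -⟩ := exists_eq_sum_rankOne (K 0) (hKrank 0)
    obtain rfl : m = 0 := by simpa using hm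
    simpa using h
  have hKT : Filter.Tendsto K Filter.atTop (𝓝 T) := by
    have hs : Summable fun k => T - K k := by
      refine summable_of_tsum_enorm_rpow_ne_top hp hp1
        (ne_top_of_le_ne_top (b := 7 * schattenSum p T) (by finiteness) (le_trans ?_ hδsum))
      gcongr with k
      refine (ENNReal.rpow_le_rpow (hKδ k) hp.le).trans ?_
      exact le_mul_of_one_le_left zero_le (one_le_pow₀ (by norm_num))
    simpa using (tendsto_const_nhds (x := T)).sub hs.tendsto_atTop_zero
  have hDrank : ∀ k, LinearMap.rank ((K (k + 1) - K k : SeqHilbert →L[ℂ] SeqHilbert) :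
      SeqHilbert →ₗ[ℂ] SeqHilbert) ≤ ((2 ^ (k + 2) : ℕ) : Cardinal) := fun k => by
    have h1 : LinearMap.rank ((-K k : SeqHilbert →L[ℂ] SeqHilbert) :
        SeqHilbert →ₗ[ℂ] SeqHilbert) ≤ ((2 ^ k - 1 : ℕ) : Cardinal) := by
      have : ((-K k : SeqHilbert →L[ℂ] SeqHilbert) : SeqHilbert →ₗ[ℂ] SeqHilbert) =
        -(K k : SeqHilbert →ₗ[ℂ] SeqHilbert) := rfl
      rw [this, LinearMap.rank, LinearMap.range_neg]
      exact hKrank k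
    rw [sub_eq_add_neg, ContinuousLinearMap.toLinearMap_add]
    refine (LinearMap.rank_add_le _ _).trans ((add_le_add (hKrank (k + 1)) h1).trans ?_)
    have : 2 ^ (k + 1) - 1 + (2 ^ k - 1) ≤ 2 ^ (k + 2) := by
      have h2 : 2 ^ (k + 1) = 2 ^ k * 2 := pow_succ 2 k
      have h4 : 2 ^ (k + 2) = 2 ^ k * 4 := pow_add 2 k 2
      omega
    exact_mod_cast this
  have hDnorm : ∀ k, ‖K (k + 1) - K k‖ₑ ≤ 2 * δ k := fun k => by
    have : K (k + 1) - K k = (T - K k) - (T - K (k + 1)) := by abel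
    rw [this, two_mul]
    exact enorm_sub_le.trans (add_le_add (hKδ k) ((hKδ (k + 1)).trans (hδanti k)))
  choose m hm x y hxy hσ using fun k => exists_eq_sum_rankOne _ (hDrank k)
  have hsum : ∑' i : Σ k, Fin (m k), (‖x i.1 i.2‖ₑ * ‖y i.1 i.2‖ₑ) ^ p ≤
      4 * 2 ^ p * 7 * schattenSum p T := by
    rw [ENNReal.tsum_sigma']
    calc _ ≤ ∑' k, 4 * 2 ^ p * (2 ^ k * δ k ^ p) := by
          refine ENNReal.tsum_le_tsum fun k => ?_
          calc _ ≤ ∑' _ : Fin (m k), (2 * δ k) ^ p := by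
                exact ENNReal.tsum_le_tsum fun i =>
                  ENNReal.rpow_le_rpow ((hσ k i).trans (hDnorm k)) hp.le
            _ = (m k : ℝ≥0∞) * (2 * δ k) ^ p := by simp
            _ ≤ (2 ^ (k + 2) : ℕ) * (2 * δ k) ^ p := by
                gcongr
                exact hm k
            _ = _ := by
                rw [ENNReal.mul_rpow_of_nonneg _ _ hp.le]
                push_cast
                ring
      _ ≤ _ := by
          rw [ENNReal.tsum_mul_left, mul_assoc _ 7]
          gcongr
  refine ⟨Σ k, Fin (m k), fun i => x i.1 i.2, fun i => y i.1 i.2, ?_, hsum⟩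
  have hsummable : Summable fun i : Σ k, Fin (m k) => rankOne ℂ (x i.1 i.2) (y i.1 i.2) := by
    refine summable_of_tsum_enorm_rpow_ne_top hp hp1 ?_
    simp only [enorm_rankOne]
    exact ne_top_of_le_ne_top (by finiteness) hsum
  have hD : HasSum (fun k => K (k + 1) - K k)
      (∑' i : Σ k, Fin (m k), rankOne ℂ (x i.1 i.2) (y i.1 i.2)) := by
    refine hsummable.hasSum.sigma fun k => ?_
    rw [hxy k]
    exact hasSum_fintype _
  have hlim := hD.tendsto_sum_nat
  simp only [Finset.sum_range_sub, hK0, sub_zero] at hlim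
  rw [← tendsto_nhds_unique hlim hKT]
  exact hsummable.hasSum

/-- The `p`-triangle inequality, up to a constant: `‖∑ Tᵢ‖_{S_p}^p ≤ C_p ∑ ‖Tᵢ‖_{S_p}^p`. -/
theorem exists_schattenSum_le_tsum {p : ℝ} (hp : 0 < p) (hp1 : p ≤ 1) :
    ∃ C : ℝ≥0∞, C ≠ ⊤ ∧ ∀ (ι : Type) (S : ι → SeqHilbert →L[ℂ] SeqHilbert)
      (T : SeqHilbert →L[ℂ] SeqHilbert), HasSum S T →
        schattenSum p T ≤ C * ∑' i, schattenSum p (S i) := by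
  obtain ⟨C₁, hC₁, h₁⟩ := exists_schattenSum_le_of_hasSum_rankOne hp hp1
  obtain ⟨C₂, hC₂, h₂⟩ := exists_atomic_decomposition hp hp1
  refine ⟨C₁ * C₂ + 1, by finiteness, fun ι S T hST => ?_⟩
  rcases eq_or_ne (∑' i, schattenSum p (S i)) ⊤ with htop | hfin
  · rw [htop, ENNReal.mul_top (by simp)]
    exact le_top
  choose κ x y hxy hσ using fun i => h₂ (S i) (ENNReal.ne_top_of_tsum_ne_top hfin i)
  have hsum : ∑' i : Σ i, κ i, (‖x i.1 i.2‖ₑ * ‖y i.1 i.2‖ₑ) ^ p ≤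
      C₂ * ∑' i, schattenSum p (S i) := by
    rw [ENNReal.tsum_sigma', ← ENNReal.tsum_mul_left]
    exact ENNReal.tsum_le_tsum hσ
  have hsummable : Summable fun i : Σ i, κ i => rankOne ℂ (x i.1 i.2) (y i.1 i.2) := by
    refine summable_of_tsum_enorm_rpow_ne_top hp hp1 ?_
    simp only [enorm_rankOne]
    exact ne_top_of_le_ne_top (by finiteness) hsum
  have hT := (hsummable.hasSum.sigma hxy).unique hST
  calc schattenSum p T ≤ C₁ * ∑' i : Σ i, κ i, (‖x i.1 i.2‖ₑ * ‖y i.1 i.2‖ₑ) ^ p :=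
        h₁ _ T _ _ (hT ▸ hsummable.hasSum)
    _ ≤ C₁ * (C₂ * ∑' i, schattenSum p (S i)) := by gcongr
    _ ≤ _ := by
        rw [add_mul, mul_assoc]
        exact le_self_add

/-! ### Matrices, coordinates and Schur multipliers -/

theorem operatorMatrix_rankOne (x y : SeqHilbert) (j k : ℕ) :
    operatorMatrix (rankOne ℂ x y) j k = x j * (starRingEnd ℂ) (y k) := by
  simp only [operatorMatrix, Matrix.of_apply, rankOne_apply, lp.inner_single_right]
  rw [lp.coeFn_smul, Pi.smul_apply, smul_eq_mul, RCLike.inner_apply, one_mul, mul_comm]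

theorem operatorMatrix_eq_inner (T : SeqHilbert →L[ℂ] SeqHilbert) (j k : ℕ) :
    operatorMatrix T j k = inner ℂ (lp.single 2 j (1 : ℂ) : SeqHilbert)
      (T (lp.single 2 k (1 : ℂ))) := by
  rw [lp.inner_single_left, RCLike.inner_apply, map_one, mul_one]
  rfl

theorem operatorMatrix_hasSum {ι : Type} {S : ι → SeqHilbert →L[ℂ] SeqHilbert}
    {T : SeqHilbert →L[ℂ] SeqHilbert} (h : HasSum S T) (j k : ℕ) :
    HasSum (fun i => operatorMatrix (S i) j k) (operatorMatrix T j k) := by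
  simp only [operatorMatrix_eq_inner]
  exact hasSum_inner_apply h _ _

/-- For `p ≤ 1`, a matrix is a Schur multiplier of `S_p` as soon as it acts boundedly on
operators of rank one. -/
theorem isSchurMultiplier_of_rankOne {p : ℝ} (hp : 0 < p) (hp1 : p ≤ 1) {A : Matrix ℕ ℕ ℂ}
    {C : ℝ≥0∞} (hC : C ≠ ⊤)
    (h : ∀ x y : SeqHilbert, ∃ T : SeqHilbert →L[ℂ] SeqHilbert,
      (∀ j k, operatorMatrix T j k = A j k * (x j * (starRingEnd ℂ) (y k))) ∧
        schattenSum p T ≤ C * (‖x‖ₑ * ‖y‖ₑ) ^ p) :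
    IsSchurMultiplier p A := by
  intro B hB
  rw [memSchatten_iff hp] at hB
  obtain ⟨C₁, hC₁, h₁⟩ := exists_schattenSum_le_tsum hp hp1
  obtain ⟨C₂, hC₂, h₂⟩ := exists_atomic_decomposition hp hp1
  obtain ⟨ι, x, y, hxy, hσ⟩ := h₂ B hB
  choose T hT hTp using fun i => h (x i) (y i)
  have hsum : ∑' i, schattenSum p (T i) ≤ C * (C₂ * schattenSum p B) := by
    refine (ENNReal.tsum_le_tsum hTp).trans ?_
    rw [ENNReal.tsum_mul_left]
    gcongr
  have hsummable : Summable T :=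
    summable_of_tsum_enorm_rpow_ne_top hp hp1 (ne_top_of_le_ne_top (by finiteness)
      ((ENNReal.tsum_le_tsum fun i => enorm_rpow_le_schattenSum p (T i)).trans hsum))
  refine ⟨∑' i, T i, (memSchatten_iff hp _).2 ?_, ?_⟩
  · exact ne_top_of_le_ne_top (by finiteness)
      ((h₁ _ _ _ hsummable.hasSum).trans (mul_le_mul_right hsum C₁))
  · ext j k
    refine (operatorMatrix_hasSum hsummable.hasSum j k).unique ?_
    simp only [hT, ← operatorMatrix_rankOne]
    exact (operatorMatrix_hasSum hxy j k).mul_left (A j k)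

theorem enorm_sq_eq_tsum (x : SeqHilbert) : ‖x‖ₑ ^ (2 : ℝ) = ∑' j, ‖x j‖ₑ ^ (2 : ℝ) := by
  have h := lp.norm_rpow_eq_tsum (p := 2) (by norm_num) x
  have hs : Summable fun j => ‖x j‖ ^ (2 : ℝ) := by
    simpa using (memℓp_gen_iff (p := 2) (by norm_num)).1 (lp.memℓp x)
  simp only [ENNReal.toReal_ofNat] at h
  rw [← ofReal_norm, ENNReal.ofReal_rpow_of_nonneg (norm_nonneg _) zero_le_two, h,
    ENNReal.ofReal_tsum_of_nonneg (fun j => by positivity) hs]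
  congr 1
  ext j
  rw [← ofReal_norm, ENNReal.ofReal_rpow_of_nonneg (norm_nonneg _) zero_le_two]

theorem exists_coordinate_mul (u : ℕ → ℂ) (hu : ∀ j, ‖u j‖ ≤ 1) (x : SeqHilbert) :
    ∃ z : SeqHilbert, (∀ j, z j = u j * x j) ∧ ‖z‖ₑ ≤ ‖x‖ₑ := by
  have hle : ∀ j, ‖u j * x j‖ ≤ ‖x j‖ := fun j => by
    rw [norm_mul]
    exact mul_le_of_le_one_left (norm_nonneg _) (hu j)
  refine ⟨⟨fun j => u j * x j, (lp.memℓp x).mono' hle⟩, fun j => rfl, ?_⟩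
  rw [← ENNReal.rpow_le_rpow_iff (z := 2) two_pos, enorm_sq_eq_tsum, enorm_sq_eq_tsum]
  gcongr with j
  rw [← ofReal_norm, ← ofReal_norm]
  exact ENNReal.ofReal_le_ofReal (hle j)

theorem norm_indicator_one_le (s : Set ℕ) (j : ℕ) : ‖s.indicator (1 : ℕ → ℂ) j‖ ≤ 1 := by
  by_cases h : j ∈ s <;> simp [h]

/-- The vector with coordinates `x j` for `j ∈ s` and `0` for `j ∉ s`. -/
noncomputable def coordRestrict (s : Set ℕ) (x : SeqHilbert) : SeqHilbert :=
  (exists_coordinate_mul (s.indicator 1) (norm_indicator_one_le s) x).choose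

theorem coordRestrict_apply (s : Set ℕ) (x : SeqHilbert) (j : ℕ) :
    coordRestrict s x j = s.indicator 1 j * x j :=
  (exists_coordinate_mul (s.indicator 1) (norm_indicator_one_le s) x).choose_spec.1 j

theorem enorm_coordRestrict_le (s : Set ℕ) (x : SeqHilbert) : ‖coordRestrict s x‖ₑ ≤ ‖x‖ₑ :=
  (exists_coordinate_mul (s.indicator 1) (norm_indicator_one_le s) x).choose_spec.2

/-- If every index lies in at most `N` of the sets `s n`, then
`∑ ‖x restricted to s n‖² ≤ N ‖x‖²`. -/
theorem tsum_enorm_coordRestrict_sq_le {ι : Type} (s : ι → Set ℕ) (N : ℝ≥0∞)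
    (hN : ∀ j, ∑' n, (s n).indicator (1 : ℕ → ℝ≥0∞) j ≤ N) (x : SeqHilbert) :
    ∑' n, ‖coordRestrict (s n) x‖ₑ ^ (2 : ℝ) ≤ N * ‖x‖ₑ ^ (2 : ℝ) := by
  simp only [enorm_sq_eq_tsum]
  rw [ENNReal.tsum_comm, ← ENNReal.tsum_mul_left]
  refine ENNReal.tsum_le_tsum fun j => ?_
  refine le_trans (le_of_eq ?_) (mul_le_mul_left (hN j) _)
  rw [← ENNReal.tsum_mul_right]
  congr 1
  ext n
  by_cases h : j ∈ s n <;> simp [coordRestrict_apply, h]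

theorem eq_sum_rankOne_of_forall_apply_eq_zero (T : SeqHilbert →L[ℂ] SeqHilbert) (s : Finset ℕ)
    (h : ∀ z, ∀ j ∉ s, T z j = 0) :
    T = ∑ j ∈ s, rankOne ℂ (lp.single 2 j (1 : ℂ))
      (ContinuousLinearMap.adjoint T (lp.single 2 j (1 : ℂ))) := by
  ext z j
  simp only [sum_apply, rankOne_apply, ContinuousLinearMap.adjoint_inner_left,
    lp.inner_single_left, lp.coeFn_sum, Finset.sum_apply, lp.coeFn_smul, Pi.smul_apply,
    smul_eq_mul, RCLike.inner_apply, map_one, mul_one, lp.coeFn_single, Pi.single_apply]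
  simp only [mul_ite, mul_one, mul_zero, Finset.sum_ite_eq]
  split_ifs with hj
  · rfl
  · exact h z j hj

theorem rank_le_of_forall_apply_eq_zero (T : SeqHilbert →L[ℂ] SeqHilbert) (s : Finset ℕ)
    (h : ∀ z, ∀ j ∉ s, T z j = 0) :
    LinearMap.rank (T : SeqHilbert →ₗ[ℂ] SeqHilbert) ≤ (s.card : Cardinal) := by
  rw [eq_sum_rankOne_of_forall_apply_eq_zero T s h]
  exact rank_sum_rankOne_le _ _ _

theorem rank_le_of_forall_adjoint_apply_eq_zero (T : SeqHilbert →L[ℂ] SeqHilbert) (s : Finset ℕ)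
    (h : ∀ z, ∀ j ∉ s, ContinuousLinearMap.adjoint T z j = 0) :
    LinearMap.rank (T : SeqHilbert →ₗ[ℂ] SeqHilbert) ≤ (s.card : Cardinal) := by
  have hT := congrArg ContinuousLinearMap.adjoint
    (eq_sum_rankOne_of_forall_apply_eq_zero (ContinuousLinearMap.adjoint T) s h)
  simp only [ContinuousLinearMap.adjoint_adjoint, map_sum, adjoint_rankOne] at hT
  rw [hT]
  exact rank_sum_rankOne_le _ _ _

/-! ### Sampling of trigonometric polynomials -/

theorem isProbabilityMeasure_unitAddCircle :
    MeasureTheory.IsProbabilityMeasure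
      (MeasureTheory.volume : MeasureTheory.Measure UnitAddCircle) :=
  ⟨UnitAddCircle.measure_univ⟩

theorem fourier_add_point (n : ℤ) (x y : UnitAddCircle) :
    (fourier n (x + y) : ℂ) = fourier n x * fourier n y := by
  simp only [fourier_apply, smul_add, AddCircle.toCircle_add, Circle.coe_mul]

theorem sum_fourier_grid {M : ℕ} (hM : 0 < M) {a : ℤ} (ha : |a| < M) (θ : UnitAddCircle) :
    ∑ t ∈ Finset.range M, (fourier a (θ + ((t / M : ℝ) : UnitAddCircle)) : ℂ) =
      if a = 0 then (M : ℂ) else 0 := by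
  split_ifs with h0
  · subst h0
    simp
  have hM0 : (M : ℂ) ≠ 0 := by exact_mod_cast hM.ne'
  set ζ : ℂ := Complex.exp (2 * Real.pi * Complex.I * a / M) with hζ
  have hpow : ∀ t : ℕ, (fourier a ((t / M : ℝ) : UnitAddCircle) : ℂ) = ζ ^ t := fun t => by
    rw [fourier_coe_apply, hζ, ← Complex.exp_nat_mul]
    congr 1
    push_cast
    ring
  have hζM : ζ ^ M = 1 := by
    rw [hζ, ← Complex.exp_nat_mul, Complex.exp_eq_one_iff]
    exact ⟨a, by field_simp⟩
  have hζ1 : ζ ≠ 1 := by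
    intro h
    rw [hζ, Complex.exp_eq_one_iff] at h
    obtain ⟨n, hn⟩ := h
    have h2 : (a : ℂ) = n * M := by
      have := Complex.two_pi_I_ne_zero
      field_simp at hn
      linear_combination hn
    have h3 : a = n * M := by exact_mod_cast h2
    have := Int.eq_zero_of_abs_lt_dvd (m := (M : ℤ)) ⟨n, by rw [h3, mul_comm]⟩ ha
    exact h0 this
  simp only [fourier_add_point, hpow, ← Finset.mul_sum]
  rw [geom_sum_eq hζ1, hζM, sub_self, zero_div, mul_zero]

/-- The trigonometric polynomial `∑_{|k| ≤ K} c_k z^k`. -/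
noncomputable def trigPoly (K : ℕ) (c : ℤ → ℂ) (x : UnitAddCircle) : ℂ :=
  ∑ k ∈ Finset.Icc (-(K : ℤ)) K, c k * fourier k x

theorem continuous_trigPoly (K : ℕ) (c : ℤ → ℂ) : Continuous (trigPoly K c) := by
  unfold trigPoly
  fun_prop

/-- Discrete Fourier inversion on a rotated grid of `4K` points; there is no aliasing for the
frequencies in `[0, 2K]`. -/
theorem sum_trigPoly_grid {K : ℕ} (hK : 0 < K) {c : ℤ → ℂ} (hc : ∀ k : ℤ, (K : ℤ) < |k| → c k = 0)
    (θ : UnitAddCircle) {n : ℤ} (h0 : 0 ≤ n) (hn : n ≤ 2 * K) :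
    ∑ t ∈ Finset.range (4 * K), trigPoly K c (θ + ((t / (4 * K : ℕ) : ℝ) : UnitAddCircle)) *
      fourier (-n) (θ + ((t / (4 * K : ℕ) : ℝ) : UnitAddCircle)) = (4 * K : ℕ) * c n := by
  simp only [trigPoly, Finset.sum_mul, mul_assoc, ← fourier_add]
  rw [Finset.sum_comm]
  simp only [← Finset.mul_sum]
  have h : ∀ k ∈ Finset.Icc (-(K : ℤ)) K,
      c k * ∑ t ∈ Finset.range (4 * K),
        (fourier (k + -n) (θ + ((t / (4 * K : ℕ) : ℝ) : UnitAddCircle)) : ℂ) =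
      if k = n then (4 * K : ℕ) * c n else 0 := by
    intro k hk
    rw [Finset.mem_Icc] at hk
    rw [sum_fourier_grid (by omega) (by rw [abs_lt]; push_cast; omega)]
    by_cases hkn : k = n
    · subst hkn
      simp [mul_comm]
    · rw [if_neg (by omega), if_neg hkn, mul_zero]
  rw [Finset.sum_congr rfl h, Finset.sum_ite_eq']
  split_ifs with hmem
  · rfl
  · rw [hc n (by
      rw [Finset.mem_Icc] at hmem
      rw [abs_of_nonneg h0]
      omega), mul_zero]

/-- Averaging over rotations of the grid shows that on some rotated grid the discrete mean of
`|f|^r` is at most its mean over the circle. -/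
theorem exists_sum_grid_le {f : UnitAddCircle → ℂ} (hf : Continuous f) (r : ℝ) (M : ℕ) :
    ∃ θ : UnitAddCircle, ∑ t ∈ Finset.range M, ‖f (θ + ((t / M : ℝ) : UnitAddCircle))‖ₑ ^ r ≤
      M * ∫⁻ x, ‖f x‖ₑ ^ r := by
  have := isProbabilityMeasure_unitAddCircle
  have hm : ∀ t : ℕ, Measurable fun θ : UnitAddCircle =>
      ‖f (θ + ((t / M : ℝ) : UnitAddCircle))‖ₑ ^ r := fun t =>
    ((hf.comp (continuous_add_const _)).measurable.enorm).pow_const r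
  obtain ⟨θ, hθ⟩ := MeasureTheory.exists_le_lintegral
    (μ := (MeasureTheory.volume : MeasureTheory.Measure UnitAddCircle))
    (Finset.measurable_fun_sum (Finset.range M) fun t _ => hm t).aemeasurable
  refine ⟨θ, hθ.trans_eq ?_⟩
  rw [MeasureTheory.lintegral_finsetSum _ fun t _ => hm t]
  have : ∀ t : ℕ, ∫⁻ θ : UnitAddCircle, ‖f (θ + ((t / M : ℝ) : UnitAddCircle))‖ₑ ^ r =
      ∫⁻ x, ‖f x‖ₑ ^ r := fun t =>
    MeasureTheory.lintegral_add_right_eq_self (fun x => ‖f x‖ₑ ^ r) _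
  simp [this]

/-! ### Hankel blocks acting on operators of rank one -/

/-- The Hankel matrix of a trigonometric polynomial of degree `K`, acting on an operator of rank
one: sampling gives a sum of `4K` operators of rank one, which controls the `S_r` quasinorm; if one
of the vectors is supported on `R` indices, Hölder's inequality passes from `S_r` to `S_p`. -/
theorem exists_hankel_block {p r : ℝ} (hp : 0 < p) (hpr : p ≤ r) (hr1 : r ≤ 1) :
    ∃ C : ℝ≥0∞, C ≠ ⊤ ∧ ∀ (K : ℕ) (c : ℤ → ℂ) (x y : SeqHilbert) (s : Finset ℕ) (R : ℕ),
      0 < K → (∀ k : ℤ, (K : ℤ) < |k| → c k = 0) →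
      (∀ j, K ≤ j → x j = 0) → (∀ k, K ≤ k → y k = 0) → s.card ≤ R →
      ((∀ j ∉ s, x j = 0) ∨ (∀ k ∉ s, y k = 0)) →
      ∃ T : SeqHilbert →L[ℂ] SeqHilbert,
        (∀ j k : ℕ, operatorMatrix T j k = c ((j : ℤ) + k) * (x j * (starRingEnd ℂ) (y k))) ∧
        schattenSum p T ≤ C * ((R : ℝ≥0∞) ^ (1 - p / r) *
          ((K : ℝ≥0∞) ^ (1 - r) * (∫⁻ z, ‖trigPoly K c z‖ₑ ^ r) *
            (‖x‖ₑ * ‖y‖ₑ) ^ r) ^ (p / r)) := by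
  have hr : 0 < r := hp.trans_le hpr
  obtain ⟨C, hC, h⟩ := exists_schattenSum_le_of_hasSum_rankOne hr hr1
  refine ⟨(C * 4 ^ (1 - r)) ^ (p / r), ?_, fun K c x y s R hK hc hx hy hs hxy => ?_⟩
  · have : 0 ≤ p / r := by positivity
    have : 0 ≤ 1 - r := by linarith
    finiteness
  obtain ⟨θ, hθ⟩ := exists_sum_grid_le (continuous_trigPoly K c) r (4 * K)
  set w : ℕ → UnitAddCircle := fun t => θ + ((t / (4 * K : ℕ) : ℝ) : UnitAddCircle) with hw
  set a : ℕ → ℂ := fun t => ((4 * K : ℕ) : ℂ)⁻¹ * trigPoly K c (w t) with ha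
  have hnorm : ∀ (n : ℤ) (z : UnitAddCircle), ‖(fourier n z : ℂ)‖ ≤ 1 := fun n z => by
    rw [fourier_apply, Circle.norm_coe]
  choose X hX hXn using fun t => exists_coordinate_mul (fun j => fourier (-(j : ℤ)) (w t))
    (fun j => hnorm _ _) x
  choose Y hY hYn using fun t => exists_coordinate_mul (fun k => fourier (k : ℤ) (w t))
    (fun k => hnorm _ _) y
  set T : SeqHilbert →L[ℂ] SeqHilbert :=
    ∑ t : Fin (4 * K), rankOne ℂ (a t • X t) (Y t) with hT
  have hentry : ∀ (t j k : ℕ), operatorMatrix (rankOne ℂ (a t • X t) (Y t)) j k =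
      ((4 * K : ℕ) : ℂ)⁻¹ * (trigPoly K c (w t) * fourier (-((j : ℤ) + k)) (w t)) *
        (x j * (starRingEnd ℂ) (y k)) := fun t j k => by
    rw [operatorMatrix_rankOne, lp.coeFn_smul, Pi.smul_apply, hX, hY, neg_add, fourier_add, map_mul,
      ← fourier_neg, smul_eq_mul, ha]
    ring
  refine ⟨T, fun j k => ?_, ?_⟩
  · refine (operatorMatrix_hasSum (hasSum_fintype _) j k).unique ?_
    simp only [hentry]
    have h4 : ((4 * K : ℕ) : ℂ) ≠ 0 := by
      have : 4 * K ≠ 0 := by omega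
      exact_mod_cast this
    have : c ((j : ℤ) + k) * (x j * (starRingEnd ℂ) (y k)) =
        ∑ t : Fin (4 * K), ((4 * K : ℕ) : ℂ)⁻¹ * (trigPoly K c (w t) *
          fourier (-((j : ℤ) + k)) (w t)) * (x j * (starRingEnd ℂ) (y k)) := by
      rcases le_or_gt K j with hj | hj
      · simp [hx j hj]
      rcases le_or_gt K k with hk | hk
      · simp [hy k hk]
      rw [Fin.sum_univ_eq_sum_range (fun t => ((4 * K : ℕ) : ℂ)⁻¹ * (trigPoly K c (w t) *
          fourier (-((j : ℤ) + k)) (w t)) * (x j * (starRingEnd ℂ) (y k))),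
        ← Finset.sum_mul, ← Finset.mul_sum,
        sum_trigPoly_grid hK hc θ (by omega) (by omega), inv_mul_cancel_left₀ h4]
    rw [this]
    exact hasSum_fintype _
  · have hrank : LinearMap.rank (T : SeqHilbert →ₗ[ℂ] SeqHilbert) ≤ (R : Cardinal) := by
      refine le_trans ?_ (show (s.card : Cardinal) ≤ R by exact_mod_cast hs)
      rcases hxy with hxs | hys
      · refine rank_le_of_forall_apply_eq_zero T s fun z j hj => ?_
        simp only [hT, sum_apply, rankOne_apply, lp.coeFn_sum, Finset.sum_apply, lp.coeFn_smul,
          Pi.smul_apply, hX, hxs j hj, mul_zero, smul_zero, Finset.sum_const_zero]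
      · refine rank_le_of_forall_adjoint_apply_eq_zero T s fun z j hj => ?_
        simp only [hT, map_sum, adjoint_rankOne, sum_apply, rankOne_apply, lp.coeFn_sum,
          Finset.sum_apply, lp.coeFn_smul, Pi.smul_apply, hY, hys j hj, mul_zero, smul_zero,
          Finset.sum_const_zero]
    have hSr : schattenSum r T ≤ (C * 4 ^ (1 - r)) * ((K : ℝ≥0∞) ^ (1 - r) *
        (∫⁻ z, ‖trigPoly K c z‖ₑ ^ r) * (‖x‖ₑ * ‖y‖ₑ) ^ r) := by
      have hM0 : ((4 * K : ℕ) : ℝ≥0∞) ≠ 0 := by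
        have : 4 * K ≠ 0 := by omega
        exact_mod_cast this
      have hMt : ((4 * K : ℕ) : ℝ≥0∞) ≠ ⊤ := ENNReal.natCast_ne_top _
      calc schattenSum r T ≤ C * ∑' t : Fin (4 * K), (‖a t • X t‖ₑ * ‖Y t‖ₑ) ^ r :=
            h _ T _ _ (hasSum_fintype _)
        _ ≤ C * ∑ t : Fin (4 * K), (((4 * K : ℕ) : ℝ≥0∞) ^ (-r) * (‖x‖ₑ * ‖y‖ₑ) ^ r) *
              ‖trigPoly K c (w t)‖ₑ ^ r := by
            rw [tsum_fintype]
            gcongr with t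
            calc (‖a t • X t‖ₑ * ‖Y t‖ₑ) ^ r
                ≤ ((((4 * K : ℕ) : ℝ≥0∞)⁻¹ * ‖trigPoly K c (w t)‖ₑ * ‖x‖ₑ) * ‖y‖ₑ) ^ r := by
                  rw [enorm_smul, ha, enorm_mul, enorm_inv (by
                    have : 4 * K ≠ 0 := by omega
                    exact_mod_cast this)]
                  have : ‖((4 * K : ℕ) : ℂ)‖ₑ = ((4 * K : ℕ) : ℝ≥0∞) := by
                    rw [← ofReal_norm, Complex.norm_natCast, ENNReal.ofReal_natCast]
                  rw [this]
                  gcongr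
                  · exact hXn t
                  · exact hYn t
              _ = _ := by
                  rw [mul_assoc, ENNReal.mul_rpow_of_nonneg _ _ hr.le,
                    ENNReal.mul_rpow_of_nonneg _ _ hr.le, ENNReal.inv_rpow, ENNReal.rpow_neg]
                  ring
        _ ≤ C * ((((4 * K : ℕ) : ℝ≥0∞) ^ (-r) * (‖x‖ₑ * ‖y‖ₑ) ^ r) *
              (((4 * K : ℕ) : ℝ≥0∞) * ∫⁻ z, ‖trigPoly K c z‖ₑ ^ r)) := by
            rw [← Finset.mul_sum,
              Fin.sum_univ_eq_sum_range (fun t => ‖trigPoly K c (w t)‖ₑ ^ r)]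
            gcongr
        _ = C * (((4 * K : ℕ) : ℝ≥0∞) ^ (1 - r) * ((∫⁻ z, ‖trigPoly K c z‖ₑ ^ r) *
              (‖x‖ₑ * ‖y‖ₑ) ^ r)) := by
            rw [sub_eq_neg_add, ENNReal.rpow_add _ _ hM0 hMt, ENNReal.rpow_one]
            ring
        _ = _ := by
            push_cast
            rw [ENNReal.mul_rpow_of_nonneg _ _ (by linarith)]
            ring
    refine (schattenSum_le_of_rank_le hp hpr T hrank).trans ?_
    rw [mul_left_comm, ← ENNReal.mul_rpow_of_nonneg _ _ (by positivity)]
    gcongr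

/-! ### Besov blocks -/

theorem IsBesovCutoff.eq_zero {v : ℝ → ℝ} (hv : IsBesovCutoff v) {x : ℝ}
    (hx : x ∉ Set.Ioo (1 / 2 : ℝ) 2) : v x = 0 := by
  have h : Function.support v ⊆ Set.Ioo (1 / 2 : ℝ) 2 := by
    rw [← interior_Icc]
    refine interior_maximal ?_ hv.smooth.continuous.isOpen_support
    rw [← hv.tsupport_eq]
    exact subset_tsupport v
  by_contra h0
  exact hx (h h0)

theorem besovKernelCoeff_natCast (v : ℝ → ℝ) (n N : ℕ) :
    besovKernelCoeff v n N =
      if n = 0 then (if N ≤ 1 then 1 else 0) else v ((N : ℝ) / 2 ^ n) := by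
  rcases Nat.eq_zero_or_pos n with rfl | hn
  · simp only [besovKernelCoeff, Nat.cast_zero, if_true, Nat.abs_cast, Nat.cast_le_one]
  · simp [besovKernelCoeff, hn, hn.ne']

theorem IsBesovCutoff.kernelCoeff_eq_zero {v : ℝ → ℝ} (hv : IsBesovCutoff v) (n : ℕ) {k : ℤ}
    (hk : ((2 ^ (n + 1) : ℕ) : ℤ) < |k|) : besovKernelCoeff v n k = 0 := by
  have hpow : (1 : ℤ) ≤ (2 ^ n : ℕ) := by exact_mod_cast Nat.one_le_two_pow
  rw [pow_succ] at hk
  push_cast at hk hpow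
  rcases le_or_gt 0 k with h0 | h0
  · obtain ⟨N, rfl⟩ := Int.eq_ofNat_of_zero_le h0
    rw [Nat.abs_cast] at hk
    rw [besovKernelCoeff_natCast]
    split_ifs with h1 h2
    · exfalso
      have : (N : ℤ) ≤ 1 := by exact_mod_cast h2
      linarith
    · rfl
    · refine hv.eq_zero fun h => ?_
      have h3 := h.2
      rw [div_lt_iff₀ (by positivity)] at h3
      have h4 : (N : ℤ) < 2 * 2 ^ n := by exact_mod_cast h3
      linarith
  · rcases Nat.eq_zero_or_pos n with rfl | hn
    · have : ¬ |k| ≤ 1 := by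
        simp only [pow_zero] at hk
        linarith
      simp only [besovKernelCoeff, Nat.cast_zero, if_true, this, if_false]
    · simp [besovKernelCoeff, hn, hn.ne', not_le.2 h0]

theorem IsBesovCutoff.lt_of_kernelCoeff_ne_zero {v : ℝ → ℝ} (hv : IsBesovCutoff v) {n N : ℕ}
    (h : besovKernelCoeff v n N ≠ 0) : N < 2 ^ (n + 1) := by
  rw [besovKernelCoeff_natCast] at h
  split_ifs at h with h1 h2
  · subst h1
    omega
  · exact absurd rfl h
  · by_contra hc
    refine h (hv.eq_zero fun hx => ?_)
    have h3 := hx.2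
    rw [div_lt_iff₀ (by positivity)] at h3
    have h4 : N < 2 * 2 ^ n := by exact_mod_cast h3
    rw [pow_succ] at hc
    omega

theorem IsBesovCutoff.lt_two_mul_of_kernelCoeff_ne_zero {v : ℝ → ℝ} (hv : IsBesovCutoff v)
    {n N : ℕ} (hn : n ≠ 0) (h : besovKernelCoeff v n N ≠ 0) : 2 ^ n < 2 * N := by
  rw [besovKernelCoeff_natCast, if_neg hn] at h
  by_contra hc
  refine h (hv.eq_zero fun hx => ?_)
  have h3 := hx.1
  rw [lt_div_iff₀ (by positivity)] at h3
  have h4 : (2 : ℝ) ^ n < 2 * N := by linarith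
  exact hc (by exact_mod_cast h4)

/-- The positions of the nonzero entries of the `n`-th dyadic block of a Hankel matrix: both
indices have at most `n + 1` binary digits, and the larger one has at least `n - 1` digits. -/
theorem IsBesovCutoff.size_le_of_kernelCoeff_ne_zero {v : ℝ → ℝ} (hv : IsBesovCutoff v)
    {n j k : ℕ} (h : besovKernelCoeff v n ((j : ℤ) + k) ≠ 0) :
    (j.size ≤ n + 1 ∧ k.size ≤ n + 1) ∧ (n ≤ j.size + 1 ∨ n ≤ k.size + 1) := by
  have h' : besovKernelCoeff v n ((j + k : ℕ) : ℤ) ≠ 0 := by exact_mod_cast h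
  have h1 := hv.lt_of_kernelCoeff_ne_zero h'
  refine ⟨⟨Nat.size_le.2 (by omega), Nat.size_le.2 (by omega)⟩, ?_⟩
  by_contra! hc
  obtain ⟨n, rfl⟩ : ∃ m, n = m + 2 := ⟨n - 2, by omega⟩
  have h2 := hv.lt_two_mul_of_kernelCoeff_ne_zero (by omega) h'
  have hj : j < 2 ^ n := Nat.size_le.1 (by omega)
  have hk : k < 2 ^ n := Nat.size_le.1 (by omega)
  rw [pow_add] at h2
  omega

theorem IsBesovCutoff.hasSum_kernelCoeff {v : ℝ → ℝ} (hv : IsBesovCutoff v) (N : ℕ) :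
    HasSum (fun n : ℕ => besovKernelCoeff v n N) 1 := by
  rcases le_or_gt N 1 with hN | hN
  · have h : (fun n : ℕ => besovKernelCoeff v n N) = fun n => if n = 0 then (1 : ℝ) else 0 := by
      ext n
      rw [besovKernelCoeff_natCast]
      split_ifs with h1
      · rfl
      · refine hv.eq_zero fun hx => ?_
        have h2 := hx.1
        rw [lt_div_iff₀ (by positivity)] at h2
        have h3 : (2 : ℝ) ^ 1 ≤ 2 ^ n := pow_le_pow_right₀ one_le_two (by omega)
        have h4 : (N : ℝ) ≤ 1 := by exact_mod_cast hN
        linarith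
    rw [h]
    exact hasSum_ite_eq 0 1
  · have h2 : (2 : ℝ) ≤ N := by exact_mod_cast hN
    refine (hv.hasSum_one N (by linarith)).congr_fun fun n => ?_
    rw [besovKernelCoeff_natCast]
    split_ifs with h1 h3
    · omega
    · subst h1
      exact (hv.eq_zero fun hx => by
        have := hx.2
        simp only [pow_zero, div_one] at this
        linarith).symm
    · rfl

/-- The Fourier coefficients of `ψ * V_n`. -/
noncomputable def blockCoeff (v : ℝ → ℝ) (c : ℤ → ℂ) (n : ℕ) (k : ℤ) : ℂ :=
  c k * (besovKernelCoeff v n k : ℂ)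

theorem besovBlock_eq_trigPoly (v : ℝ → ℝ) (c : ℤ → ℂ) (n : ℕ) :
    besovBlock v c n = trigPoly (2 ^ (n + 1)) (blockCoeff v c n) := by
  ext x
  simp only [besovBlock, trigPoly, blockCoeff, Int.natAbs_natCast]
  push_cast
  rfl

theorem IsBesovCutoff.hasSum_blockCoeff {v : ℝ → ℝ} (hv : IsBesovCutoff v) (c : ℤ → ℂ) (N : ℕ) :
    HasSum (fun n : ℕ => blockCoeff v c n N) (c N) := by
  have h := (Complex.hasSum_ofReal.2 (hv.hasSum_kernelCoeff N)).mul_left (c N)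
  simpa [blockCoeff] using h

/-- The quantity `2^(n s) ‖ψ * V_n‖_{L^r}` with values in `[0, ∞]`. -/
noncomputable def besovETerm (v : ℝ → ℝ) (s r : ℝ) (c : ℤ → ℂ) (n : ℕ) : ℝ≥0∞ :=
  ENNReal.ofReal (besovTerm v s (ENNReal.ofReal r) c n)

theorem eLpNorm_besovBlock_ne_top (v : ℝ → ℝ) (c : ℤ → ℂ) (n : ℕ) (r : ℝ≥0∞) :
    MeasureTheory.eLpNorm (besovBlock v c n) r MeasureTheory.volume ≠ ⊤ := by
  have := isProbabilityMeasure_unitAddCircle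
  rw [besovBlock_eq_trigPoly]
  have hc := continuous_trigPoly (2 ^ (n + 1)) (blockCoeff v c n)
  obtain ⟨B, hB⟩ := isCompact_univ.exists_bound_of_continuousOn hc.continuousOn
  exact (MeasureTheory.MemLp.of_bound hc.aestronglyMeasurable B
    (Filter.Eventually.of_forall fun x => hB x (Set.mem_univ x))).eLpNorm_ne_top

theorem besovETerm_eq (v : ℝ → ℝ) (s r : ℝ) (c : ℤ → ℂ) (n : ℕ) :
    besovETerm v s r c n = 2 ^ ((n : ℝ) * s) *
      MeasureTheory.eLpNorm (besovBlock v c n) (ENNReal.ofReal r) MeasureTheory.volume := by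
  rw [besovETerm, besovTerm, ENNReal.ofReal_mul (by positivity),
    ENNReal.ofReal_toReal (eLpNorm_besovBlock_ne_top v c n _),
    ← ENNReal.ofReal_rpow_of_pos two_pos, ENNReal.ofReal_ofNat, Int.natAbs_natCast]

theorem tsum_besovETerm_rpow_ne_top {v : ℝ → ℝ} {s r q : ℝ} {c : ℤ → ℂ} (hq : 0 < q)
    (h : Memℓp (fun n : ℕ => besovTerm v s (ENNReal.ofReal r) c n) (ENNReal.ofReal q)) :
    ∑' n, besovETerm v s r c n ^ q ≠ ⊤ := by
  rw [memℓp_gen_iff (by rwa [ENNReal.toReal_ofReal hq.le]), ENNReal.toReal_ofReal hq.le] at h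
  have h0 : ∀ n : ℕ, 0 ≤ besovTerm v s (ENNReal.ofReal r) c n := fun n => by
    unfold besovTerm
    positivity
  simp only [besovETerm, ENNReal.ofReal_rpow_of_nonneg (h0 _) hq.le]
  refine Summable.tsum_ofReal_ne_top (h.congr fun n => ?_)
  rw [Real.norm_of_nonneg (h0 n)]

/-- The `S_p` bound for the `n`-th block, acting on an operator of rank one supported on
`[0, 2^(n+1))`, when one of the two vectors is supported on at most `2^m` indices. -/
theorem exists_besov_block {p r : ℝ} (hp : 0 < p) (hpr : p ≤ r) (hr1 : r ≤ 1) :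
    ∃ C : ℝ≥0∞, C ≠ ⊤ ∧ ∀ (v : ℝ → ℝ) (c : ℤ → ℂ) (n m : ℕ) (x y : SeqHilbert) (s : Finset ℕ),
      IsBesovCutoff v → (∀ j, 2 ^ (n + 1) ≤ j → x j = 0) → (∀ k, 2 ^ (n + 1) ≤ k → y k = 0) →
      s.card ≤ 2 ^ m → ((∀ j ∉ s, x j = 0) ∨ (∀ k ∉ s, y k = 0)) →
      ∃ T : SeqHilbert →L[ℂ] SeqHilbert,
        (∀ j k : ℕ, operatorMatrix T j k =
          blockCoeff v c n ((j : ℤ) + k) * (x j * (starRingEnd ℂ) (y k))) ∧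
        schattenSum p T ≤ C * (2 ^ (-(((n : ℝ) - m) * (1 - p / r))) *
          (besovETerm v (invSharp p) r c n ^ p * (‖x‖ₑ * ‖y‖ₑ) ^ p)) := by
  have hr : 0 < r := hp.trans_le hpr
  obtain ⟨C, hC, h⟩ := exists_hankel_block hp hpr hr1
  refine ⟨C * 2 ^ (p / r - p), by finiteness, fun v c n m x y s hv hx hy hs hxy => ?_⟩
  obtain ⟨T, hT, hTp⟩ := h (2 ^ (n + 1)) (blockCoeff v c n) x y s (2 ^ m) (by positivity)
    (fun k hk => by rw [blockCoeff, hv.kernelCoeff_eq_zero n hk]; simp) hx hy hs hxy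
  refine ⟨T, hT, hTp.trans_eq ?_⟩
  have hI : ∫⁻ z, ‖trigPoly (2 ^ (n + 1)) (blockCoeff v c n) z‖ₑ ^ r =
      MeasureTheory.eLpNorm (besovBlock v c n) (ENNReal.ofReal r) MeasureTheory.volume ^ r := by
    rw [MeasureTheory.eLpNorm_eq_lintegral_rpow_enorm_toReal
      (by simpa using hr) ENNReal.ofReal_ne_top, ENNReal.toReal_ofReal hr.le, ← ENNReal.rpow_mul,
      one_div, inv_mul_cancel₀ hr.ne', ENNReal.rpow_one, besovBlock_eq_trigPoly]
  have hpr0 : 0 ≤ p / r := by positivity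
  have h2m : ((2 ^ m : ℕ) : ℝ≥0∞) = 2 ^ (m : ℝ) := by
    rw [ENNReal.rpow_natCast]
    push_cast
    rfl
  have h2n : ((2 ^ (n + 1) : ℕ) : ℝ≥0∞) = 2 ^ ((n : ℝ) + 1) := by
    have : (n : ℝ) + 1 = ((n + 1 : ℕ) : ℝ) := by push_cast; rfl
    rw [this, ENNReal.rpow_natCast]
    push_cast
    rfl
  rw [hI, besovETerm_eq, h2m, h2n, ENNReal.mul_rpow_of_nonneg _ _ hpr0,
    ENNReal.mul_rpow_of_nonneg _ _ hpr0, ENNReal.mul_rpow_of_nonneg (2 ^ ((n : ℝ) * invSharp p)) _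
    hp.le]
  simp only [← ENNReal.rpow_mul]
  rw [mul_div_cancel₀ p hr.ne']
  have hexp : (2 : ℝ≥0∞) ^ ((m : ℝ) * (1 - p / r)) * 2 ^ (((n : ℝ) + 1) * ((1 - r) * (p / r))) =
      2 ^ (p / r - p) * 2 ^ (-(((n : ℝ) - m) * (1 - p / r))) * 2 ^ ((n : ℝ) * invSharp p * p) := by
    simp only [← two_rpow_add]
    congr 1
    have h1 : invSharp p * p = 1 - p := by
      rw [invSharp]
      field_simp
    rw [mul_assoc (n : ℝ), h1]
    field_simp
    ring
  calc _ = C * ((2 : ℝ≥0∞) ^ ((m : ℝ) * (1 - p / r)) *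
        2 ^ (((n : ℝ) + 1) * ((1 - r) * (p / r)))) *
        (MeasureTheory.eLpNorm (besovBlock v c n) (ENNReal.ofReal r) MeasureTheory.volume ^ p *
          (‖x‖ₑ * ‖y‖ₑ) ^ p) := by
        simp only [mul_assoc]
    _ = _ := by
        rw [hexp]
        ring

/-! ### Assembling the dyadic blocks -/

theorem tsum_rpow_mul_rpow_le {ι : Type} (f g : ι → ℝ≥0∞) {a b : ℝ} (ha : 0 ≤ a) (hb : 0 ≤ b)
    (hab : a + b = 1) : ∑' i, f i ^ a * g i ^ b ≤ (∑' i, f i) ^ a * (∑' i, g i) ^ b := by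
  let _ : MeasurableSpace ι := ⊤
  have h := ENNReal.lintegral_mul_norm_pow_le (μ := MeasureTheory.Measure.count)
    (f := f) (g := g) measurable_from_top.aemeasurable measurable_from_top.aemeasurable ha hb hab
  simpa only [MeasureTheory.lintegral_count] using h

theorem tsum_rpow_mul_rpow_mul_rpow_le {ι : Type} (f g h : ι → ℝ≥0∞) {a b : ℝ} (ha : 0 ≤ a)
    (hb : 0 < b) (hab : a + 2 * b = 1) :
    ∑' i, f i ^ a * (g i ^ b * h i ^ b) ≤
      (∑' i, f i) ^ a * ((∑' i, g i) ^ b * (∑' i, h i) ^ b) := by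
  have hpow : ∀ u w : ℝ≥0∞, (u ^ (1 / 2 : ℝ) * w ^ (1 / 2 : ℝ)) ^ (2 * b) = u ^ b * w ^ b := by
    intro u w
    rw [ENNReal.mul_rpow_of_nonneg _ _ (by positivity), ← ENNReal.rpow_mul, ← ENNReal.rpow_mul]
    congr 2 <;> ring
  calc _ = ∑' i, f i ^ a * (g i ^ (1 / 2 : ℝ) * h i ^ (1 / 2 : ℝ)) ^ (2 * b) := by
        simp only [hpow]
    _ ≤ (∑' i, f i) ^ a * (∑' i, g i ^ (1 / 2 : ℝ) * h i ^ (1 / 2 : ℝ)) ^ (2 * b) :=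
        tsum_rpow_mul_rpow_le _ _ ha (by positivity) hab
    _ ≤ (∑' i, f i) ^ a *
          ((∑' i, g i) ^ (1 / 2 : ℝ) * (∑' i, h i) ^ (1 / 2 : ℝ)) ^ (2 * b) := by
        gcongr
        exact tsum_rpow_mul_rpow_le g h (by norm_num) (by norm_num) (by norm_num)
    _ = _ := by rw [hpow]

/-- A matrix that is entrywise the sum of matrices of operators `Sᵢ` with `∑ ‖Sᵢ‖_{S_p}^p < ∞` is
the matrix of an operator of class `S_p`. -/
theorem exists_operator_of_pieces {p : ℝ} (hp : 0 < p) (hp1 : p ≤ 1) :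
    ∃ C : ℝ≥0∞, C ≠ ⊤ ∧ ∀ (ι : Type) (S : ι → SeqHilbert →L[ℂ] SeqHilbert) (A : ℕ → ℕ → ℂ),
      ∑' i, schattenSum p (S i) ≠ ⊤ →
      (∀ j k, HasSum (fun i => operatorMatrix (S i) j k) (A j k)) →
      ∃ T : SeqHilbert →L[ℂ] SeqHilbert, (∀ j k, operatorMatrix T j k = A j k) ∧
        schattenSum p T ≤ C * ∑' i, schattenSum p (S i) := by
  obtain ⟨C, hC, h⟩ := exists_schattenSum_le_tsum hp hp1
  refine ⟨C, hC, fun ι S A hS hA => ?_⟩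
  have hsummable : Summable S :=
    summable_of_tsum_enorm_rpow_ne_top hp hp1 (ne_top_of_le_ne_top hS
      (ENNReal.tsum_le_tsum fun i => enorm_rpow_le_schattenSum p (S i)))
  exact ⟨∑' i, S i, fun j k => (operatorMatrix_hasSum hsummable.hasSum j k).unique (hA j k),
    h _ _ _ hsummable.hasSum⟩

theorem coordRestrict_apply_of_mem {s : Set ℕ} {j : ℕ} (h : j ∈ s) (x : SeqHilbert) :
    coordRestrict s x j = x j := by simp [coordRestrict_apply, h]

theorem coordRestrict_apply_of_notMem {s : Set ℕ} {j : ℕ} (h : j ∉ s) (x : SeqHilbert) :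
    coordRestrict s x j = 0 := by simp [coordRestrict_apply, h]

/-- The indices with between `n - 1` and `n + 1` binary digits. -/
def dyadicBand (n : ℕ) : Set ℕ := {j | n ≤ j.size + 1 ∧ j.size ≤ n + 1}

theorem tsum_indicator_dyadicBand_le (j : ℕ) :
    ∑' n, (dyadicBand n).indicator (1 : ℕ → ℝ≥0∞) j ≤ 3 := by
  rw [tsum_eq_sum (s := Finset.Icc (j.size - 1) (j.size + 1)) (fun n hn => by
    refine Set.indicator_of_notMem (fun h => hn ?_) _
    rw [Finset.mem_Icc]
    have h1 := h.1
    have h2 := h.2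
    omega)]
  calc _ ≤ ∑ _n ∈ Finset.Icc (j.size - 1) (j.size + 1), (1 : ℝ≥0∞) :=
        Finset.sum_le_sum fun n _ => Set.indicator_le_self' (fun _ _ => zero_le) j
    _ ≤ 3 := by
        rw [Finset.sum_const, nsmul_eq_mul, mul_one, Nat.card_Icc]
        have : j.size + 1 + 1 - (j.size - 1) ≤ 3 := by omega
        exact_mod_cast this

/-- Each dyadic block involves one of the two vectors only through a band of indices; Hölder's
inequality with the square-summability of these pieces gives the exponent `p_♭`. -/
theorem isSchurMultiplier_of_tsum_flatExp {p : ℝ} (hp : 0 < p) (hp1 : p ≤ 1) {v : ℝ → ℝ}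
    (hv : IsBesovCutoff v) {c : ℤ → ℂ}
    (hA : ∑' n, besovETerm v (invSharp p) p c n ^ flatExp p ≠ ⊤) :
    IsSchurMultiplier p (hankelMatrix c) := by
  obtain ⟨C₁, hC₁, h₁⟩ := exists_besov_block hp le_rfl hp1
  obtain ⟨C₂, hC₂, h₂⟩ := exists_schattenSum_le_tsum hp hp1
  obtain ⟨C₃, hC₃, h₃⟩ := exists_operator_of_pieces hp hp1
  set A := besovETerm v (invSharp p) p c
  set S := (∑' n, A n ^ flatExp p) ^ (1 - p / 2) with hS
  have hSt : S ≠ ⊤ := ENNReal.rpow_ne_top_of_nonneg (by linarith) hA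
  have hexp : flatExp p * (1 - p / 2) = p := by
    have : 2 - p ≠ 0 := by linarith
    rw [flatExp]
    field_simp
  have hholder : ∀ x : SeqHilbert,
      ∑' n, A n ^ p * ‖coordRestrict (dyadicBand n) x‖ₑ ^ p ≤ S * (3 ^ (p / 2) * ‖x‖ₑ ^ p) := by
    intro x
    calc _ = ∑' n, (A n ^ flatExp p) ^ (1 - p / 2) *
          (‖coordRestrict (dyadicBand n) x‖ₑ ^ (2 : ℝ)) ^ (p / 2) := by
          simp only [← ENNReal.rpow_mul, hexp, mul_div_cancel₀ p (two_ne_zero (α := ℝ))]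
      _ ≤ S * (∑' n, ‖coordRestrict (dyadicBand n) x‖ₑ ^ (2 : ℝ)) ^ (p / 2) :=
          tsum_rpow_mul_rpow_le _ _ (by linarith) (by positivity) (by ring)
      _ ≤ S * (3 * ‖x‖ₑ ^ (2 : ℝ)) ^ (p / 2) := by
          gcongr
          exact tsum_enorm_coordRestrict_sq_le _ 3 tsum_indicator_dyadicBand_le x
      _ = _ := by
          rw [ENNReal.mul_rpow_of_nonneg _ _ (by positivity), ← ENNReal.rpow_mul,
            mul_div_cancel₀ p (two_ne_zero (α := ℝ))]
  refine isSchurMultiplier_of_rankOne hp hp1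
    (C := C₃ * (C₂ * (C₁ * (2 * (S * 3 ^ (p / 2)))))) (by finiteness) fun x y => ?_
  set F : ℕ → Set ℕ := fun n => {j | j.size ≤ n + 1} with hF
  set L : ℕ → Set ℕ := fun n => {j | j.size + 1 < n} with hL
  have hsupp : ∀ (n : ℕ) (s : Set ℕ) (x : SeqHilbert), (∀ j ∈ s, j.size ≤ n + 1) →
      ∀ j, 2 ^ (n + 1) ≤ j → coordRestrict s x j = 0 := fun n s x hs j hj =>
    coordRestrict_apply_of_notMem (fun h => absurd (Nat.size_le.1 (hs j h)) (not_lt.2 hj)) x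
  have hblock : ∀ (n : ℕ) (s t : Set ℕ), (∀ j ∈ s, j.size ≤ n + 1) → (∀ j ∈ t, j.size ≤ n + 1) →
      ∃ T : SeqHilbert →L[ℂ] SeqHilbert, (∀ j k : ℕ, operatorMatrix T j k =
          blockCoeff v c n ((j : ℤ) + k) *
            (coordRestrict s x j * (starRingEnd ℂ) (coordRestrict t y k))) ∧
        schattenSum p T ≤ C₁ * (A n ^ p * (‖coordRestrict s x‖ₑ * ‖coordRestrict t y‖ₑ) ^ p) := by
    intro n s t hs ht
    obtain ⟨T, hT, hTp⟩ := h₁ v c n (n + 1) (coordRestrict s x) (coordRestrict t y)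
      (Finset.range (2 ^ (n + 1))) hv (hsupp n s x hs) (hsupp n t y ht) (by simp)
      (Or.inl fun j hj => hsupp n s x hs j (by simpa using hj))
    refine ⟨T, hT, ?_⟩
    simpa [div_self hp.ne'] using hTp
  choose T₁ hT₁ hT₁p using fun n => hblock n (dyadicBand n) (F n) (fun j h => h.2) (fun j h => h)
  choose T₂ hT₂ hT₂p using fun n => hblock n (L n) (dyadicBand n)
    (fun j h => (show j.size ≤ n + 1 by have : j.size + 1 < n := h; omega)) (fun j h => h.2)
  have hadd : ∀ n, schattenSum p (T₁ n + T₂ n) ≤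
      C₂ * (schattenSum p (T₁ n) + schattenSum p (T₂ n)) := fun n => by
    have := h₂ Bool (fun b => if b then T₁ n else T₂ n) (T₁ n + T₂ n) (by
      have := hasSum_fintype (fun b : Bool => if b then T₁ n else T₂ n)
      simpa using this)
    simpa [tsum_fintype] using this
  have hsum : ∑' n, schattenSum p (T₁ n + T₂ n) ≤
      C₂ * (C₁ * (2 * (S * 3 ^ (p / 2)))) * (‖x‖ₑ * ‖y‖ₑ) ^ p := by
    calc _ ≤ ∑' n, C₂ * (C₁ * (A n ^ p * ‖coordRestrict (dyadicBand n) x‖ₑ ^ p * ‖y‖ₑ ^ p) +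
          C₁ * (A n ^ p * ‖coordRestrict (dyadicBand n) y‖ₑ ^ p * ‖x‖ₑ ^ p)) := by
          refine ENNReal.tsum_le_tsum fun n => (hadd n).trans ?_
          gcongr
          · refine (hT₁p n).trans ?_
            rw [ENNReal.mul_rpow_of_nonneg _ _ hp.le, mul_assoc (A n ^ p)]
            gcongr
            exact enorm_coordRestrict_le _ _
          · refine (hT₂p n).trans ?_
            rw [ENNReal.mul_rpow_of_nonneg _ _ hp.le, mul_assoc (A n ^ p),
              mul_comm (‖coordRestrict (L n) x‖ₑ ^ p)]
            gcongr
            exact enorm_coordRestrict_le _ _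
      _ = C₂ * (C₁ * ((∑' n, A n ^ p * ‖coordRestrict (dyadicBand n) x‖ₑ ^ p) * ‖y‖ₑ ^ p) +
          C₁ * ((∑' n, A n ^ p * ‖coordRestrict (dyadicBand n) y‖ₑ ^ p) * ‖x‖ₑ ^ p)) := by
          simp only [ENNReal.tsum_mul_left, ENNReal.tsum_mul_right, ENNReal.tsum_add]
      _ ≤ C₂ * (C₁ * ((S * (3 ^ (p / 2) * ‖x‖ₑ ^ p)) * ‖y‖ₑ ^ p) +
          C₁ * ((S * (3 ^ (p / 2) * ‖y‖ₑ ^ p)) * ‖x‖ₑ ^ p)) := by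
          gcongr
          · exact hholder x
          · exact hholder y
      _ = _ := by
          rw [ENNReal.mul_rpow_of_nonneg _ _ hp.le]
          ring
  obtain ⟨T, hT, hTp⟩ := h₃ ℕ (fun n => T₁ n + T₂ n)
    (fun j k => hankelMatrix c j k * (x j * (starRingEnd ℂ) (y k)))
    (ne_top_of_le_ne_top (by finiteness) hsum) (fun j k => by
      have hc := (hv.hasSum_blockCoeff c (j + k)).mul_right (x j * (starRingEnd ℂ) (y k))
      push_cast at hc
      refine hc.congr_fun fun n => ?_
      have hsplit : operatorMatrix (T₁ n + T₂ n) j k =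
        operatorMatrix (T₁ n) j k + operatorMatrix (T₂ n) j k := rfl
      rw [hsplit, hT₁, hT₂, ← mul_add]
      rcases eq_or_ne (blockCoeff v c n ((j : ℤ) + k)) 0 with h0 | h0
      · simp [h0]
      · have hk : besovKernelCoeff v n ((j : ℤ) + k) ≠ 0 := fun h => h0 (by simp [blockCoeff, h])
        obtain ⟨⟨hj1, hk1⟩, hor⟩ := hv.size_le_of_kernelCoeff_ne_zero hk
        congr 1
        rcases le_or_gt n (j.size + 1) with hjn | hjn
        · rw [coordRestrict_apply_of_mem (show j ∈ dyadicBand n from ⟨hjn, hj1⟩),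
            coordRestrict_apply_of_mem (show k ∈ F n from hk1),
            coordRestrict_apply_of_notMem (show j ∉ L n from not_lt.2 hjn), zero_mul, add_zero]
        · rw [coordRestrict_apply_of_notMem (show j ∉ dyadicBand n from fun h => by
              have := h.1
              omega),
            coordRestrict_apply_of_mem (show j ∈ L n from hjn),
            coordRestrict_apply_of_mem (show k ∈ dyadicBand n from ⟨by omega, hk1⟩), zero_mul,
            zero_add])
  refine ⟨T, hT, hTp.trans ?_⟩
  rw [mul_assoc C₃]
  gcongr

/-- The indices with exactly `l` binary digits. -/
def dyadicLayer (l : ℕ) : Set ℕ := {j | j.size = l}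

theorem tsum_indicator_dyadicLayer_le (j : ℕ) :
    ∑' l, (dyadicLayer l).indicator (1 : ℕ → ℝ≥0∞) j ≤ 1 := by
  rw [tsum_eq_single j.size fun l hl =>
    Set.indicator_of_notMem (show j ∉ dyadicLayer l from fun h => hl h.symm) _]
  exact Set.indicator_le_self' (fun _ _ => zero_le) j

/-- The weights `2^(-γ|n - l|)`, measuring the distance between dyadic scales. -/
noncomputable def scaleWeight (γ : ℝ) (n l : ℕ) : ℝ≥0∞ := 2 ^ (-(γ * |(n : ℝ) - l|))

theorem scaleWeight_comm (γ : ℝ) (n l : ℕ) : scaleWeight γ n l = scaleWeight γ l n := by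
  rw [scaleWeight, scaleWeight, abs_sub_comm]

theorem tsum_scaleWeight_le {γ : ℝ} (n : ℕ) :
    ∑' l, scaleWeight γ n l ≤ 2 * ∑' m : ℕ, (2 : ℝ≥0∞) ^ (-(γ * m)) := by
  rw [← Summable.sum_add_tsum_nat_add' (f := scaleWeight γ n) (k := n) ENNReal.summable, two_mul]
  refine add_le_add ?_ (ENNReal.tsum_le_tsum fun m => ?_)
  · rw [← Finset.sum_range_reflect]
    calc _ ≤ ∑ m ∈ Finset.range n, (2 : ℝ≥0∞) ^ (-(γ * (m + 1 : ℕ))) := by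
          refine Finset.sum_le_sum fun m hm => ?_
          rw [Finset.mem_range] at hm
          have : (n : ℝ) - (n - 1 - m : ℕ) = (m + 1 : ℕ) := by
            have : (n : ℝ) = (n - 1 - m : ℕ) + (m + 1 : ℕ) := by
              rw [← Nat.cast_add]
              congr 1
              omega
            linarith
          rw [scaleWeight, this, Nat.abs_cast]
      _ ≤ ∑' m : ℕ, (2 : ℝ≥0∞) ^ (-(γ * (m + 1 : ℕ))) := ENNReal.sum_le_tsum _
      _ ≤ _ := ENNReal.tsum_comp_le_tsum_of_injective (Nat.succ_injective)
          (fun m : ℕ => (2 : ℝ≥0∞) ^ (-(γ * m)))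
  · have : (n : ℝ) - (m + n : ℕ) = -m := by push_cast; ring
    rw [scaleWeight, this, abs_neg, Nat.abs_cast]

/-- If the larger of the scales `l`, `m` is within one step of `n`, the factor decaying in `n - l`
is at most a constant times the product of the weights of both scales. -/
theorem two_rpow_le_scaleWeight {γ : ℝ} (hγ : 0 ≤ γ) {n l m : ℕ} (hlm : l ≤ m) (hmn : m ≤ n + 1)
    (hnm : n ≤ m + 1) :
    (2 : ℝ≥0∞) ^ (-(((n : ℝ) - l) * γ)) ≤
      2 ^ (3 * γ) * (scaleWeight γ n l * scaleWeight γ n m) := by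
  simp only [scaleWeight, ← two_rpow_add]
  refine ENNReal.rpow_le_rpow_of_exponent_le (by norm_num) ?_
  have h1 : (l : ℝ) ≤ m := by exact_mod_cast hlm
  have h2 : (m : ℝ) ≤ n + 1 := by exact_mod_cast hmn
  have h3 : (n : ℝ) ≤ m + 1 := by exact_mod_cast hnm
  have h4 : |(n : ℝ) - m| ≤ 1 := abs_le.2 ⟨by linarith, by linarith⟩
  have h5 : |(n : ℝ) - l| ≤ n - l + 2 := abs_le.2 ⟨by linarith, by linarith⟩
  have : γ * (|(n : ℝ) - l| + |(n : ℝ) - m|) ≤ γ * (n - l + 3) := by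
    exact mul_le_mul_of_nonneg_left (by linarith) hγ
  linarith

theorem mul_rpow_mul_rpow_eq {p : ℝ} (hp : 0 < p) (hp1 : p < 1) (w a b c : ℝ≥0∞) :
    w * (a ^ p * (b * c) ^ p) = (w * a ^ (p / (1 - p))) ^ (1 - p) *
      ((w * b ^ (2 : ℝ)) ^ (p / 2) * (w * c ^ (2 : ℝ)) ^ (p / 2)) := by
  have h1p : 0 ≤ 1 - p := by linarith
  have hp2 : 0 ≤ p / 2 := by linarith
  have hw : w = w ^ (1 - p) * (w ^ (p / 2) * w ^ (p / 2)) := by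
    rw [← ENNReal.rpow_add_of_nonneg _ _ hp2 hp2, ← ENNReal.rpow_add_of_nonneg _ _ h1p
      (by linarith), add_halves, sub_add_cancel, ENNReal.rpow_one]
  rw [ENNReal.mul_rpow_of_nonneg w _ h1p, ENNReal.mul_rpow_of_nonneg w _ hp2,
    ENNReal.mul_rpow_of_nonneg w _ hp2, ENNReal.mul_rpow_of_nonneg _ _ hp.le,
    ← ENNReal.rpow_mul, ← ENNReal.rpow_mul, ← ENNReal.rpow_mul,
    div_mul_cancel₀ p (by linarith : 1 - p ≠ 0), mul_div_cancel₀ p (two_ne_zero (α := ℝ))]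
  conv_lhs => rw [hw]
  ring

/-- If the smoothness is measured in `L^r` with `r > p`, the blocks decay away from the diagonal:
a piece whose indices have `l` and `m` binary digits has rank at most `2^min(l, m)`. Both vectors
then contribute a square-summable factor, which gives the exponent `p_#`. -/
theorem isSchurMultiplier_of_tsum_sharpExp {p r : ℝ} (hp : 0 < p) (hpr : p < r) (hr1 : r ≤ 1)
    {v : ℝ → ℝ} (hv : IsBesovCutoff v) {c : ℤ → ℂ}
    (hA : ∑' n, besovETerm v (invSharp p) r c n ^ (p / (1 - p)) ≠ ⊤) :
    IsSchurMultiplier p (hankelMatrix c) := by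
  have hp1 : p < 1 := hpr.trans_le hr1
  have hr : 0 < r := hp.trans hpr
  obtain ⟨C₁, hC₁, h₁⟩ := exists_besov_block hp hpr.le hr1
  obtain ⟨C₃, hC₃, h₃⟩ := exists_operator_of_pieces hp hp1.le
  set A := besovETerm v (invSharp p) r c
  set γ := 1 - p / r with hγ_def
  have hγ : 0 < γ := by
    rw [hγ_def, sub_pos, div_lt_one hr]
    exact hpr
  set G : ℝ≥0∞ := 2 * ∑' m : ℕ, (2 : ℝ≥0∞) ^ (-(γ * m)) with hG
  have hGt : G ≠ ⊤ := ENNReal.mul_ne_top (by norm_num) (tsum_two_rpow_neg_ne_top hγ)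
  have hW : ∀ n, ∑' l, scaleWeight γ n l ≤ G := fun n => tsum_scaleWeight_le n
  set S := ∑' n, A n ^ (p / (1 - p)) with hS
  have h1p : 0 ≤ 1 - p := by linarith
  have hp2 : 0 ≤ p / 2 := by linarith
  refine isSchurMultiplier_of_rankOne hp hp1.le
    (C := C₃ * (C₁ * 2 ^ (3 * γ) * ((G * (G * S)) ^ (1 - p) * ((G * G) ^ (p / 2) *
      (G * G) ^ (p / 2))))) (by finiteness) fun x y => ?_
  set B : ℕ → Set ℕ := dyadicLayer
  set X : ℕ → ℝ≥0∞ := fun l => ‖coordRestrict (B l) x‖ₑ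
  set Y : ℕ → ℝ≥0∞ := fun m => ‖coordRestrict (B m) y‖ₑ
  have hsupp : ∀ (l N : ℕ) (z : SeqHilbert), l ≤ N → ∀ j, 2 ^ N ≤ j →
      coordRestrict (B l) z j = 0 := fun l N z hl j hj =>
    coordRestrict_apply_of_notMem (show j ∉ B l from fun h =>
      absurd (Nat.size_le.1 ((show j.size = l from h).trans_le hl)) (not_lt.2 hj)) z
  have hpiece : ∀ i : ℕ × ℕ × ℕ, ∃ T : SeqHilbert →L[ℂ] SeqHilbert,
      (∀ j k : ℕ, operatorMatrix T j k = blockCoeff v c i.1 ((j : ℤ) + k) *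
        (coordRestrict (B i.2.1) x j * (starRingEnd ℂ) (coordRestrict (B i.2.2) y k))) ∧
      schattenSum p T ≤ C₁ * 2 ^ (3 * γ) * (scaleWeight γ i.1 i.2.1 * scaleWeight γ i.1 i.2.2 *
        (A i.1 ^ p * (X i.2.1 * Y i.2.2) ^ p)) := by
    rintro ⟨n, l, m⟩
    dsimp only
    by_cases hcond : (l ≤ n + 1 ∧ m ≤ n + 1) ∧ (n ≤ l + 1 ∨ n ≤ m + 1)
    · obtain ⟨⟨hl, hm⟩, hor⟩ := hcond
      rcases le_total l m with hlm | hlm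
      · obtain ⟨T, hT, hTp⟩ := h₁ v c n l (coordRestrict (B l) x) (coordRestrict (B m) y)
          (Finset.range (2 ^ l)) hv (hsupp l _ x hl) (hsupp m _ y hm) (by simp)
          (Or.inl fun j hj => hsupp l l x le_rfl j (by simpa using hj))
        refine ⟨T, hT, hTp.trans ?_⟩
        rw [mul_assoc C₁, ← mul_assoc (2 ^ (3 * γ))]
        gcongr
        exact two_rpow_le_scaleWeight hγ.le hlm hm (by omega)
      · obtain ⟨T, hT, hTp⟩ := h₁ v c n m (coordRestrict (B l) x) (coordRestrict (B m) y)
          (Finset.range (2 ^ m)) hv (hsupp l _ x hl) (hsupp m _ y hm) (by simp)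
          (Or.inr fun j hj => hsupp m m y le_rfl j (by simpa using hj))
        refine ⟨T, hT, hTp.trans ?_⟩
        rw [mul_assoc C₁, ← mul_assoc (2 ^ (3 * γ)), mul_comm (scaleWeight γ n l)]
        gcongr
        exact two_rpow_le_scaleWeight hγ.le hlm hl (by omega)
    · refine ⟨0, fun j k => ?_, by rw [schattenSum_zero hp]; exact zero_le⟩
      have h0 : operatorMatrix (0 : SeqHilbert →L[ℂ] SeqHilbert) j k = 0 := rfl
      rw [h0]
      by_contra hne
      have hne' := Ne.symm hne
      simp only [ne_eq, mul_eq_zero, map_eq_zero, not_or] at hne'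
      obtain ⟨hd, hj, hk⟩ := hne'
      have hj' : j.size = l := by
        by_contra h
        exact hj (coordRestrict_apply_of_notMem (show j ∉ B l from h) x)
      have hk' : k.size = m := by
        by_contra h
        exact hk (coordRestrict_apply_of_notMem (show k ∉ B m from h) y)
      have := hv.size_le_of_kernelCoeff_ne_zero (n := n) (j := j) (k := k)
        (fun h => hd (by simp [blockCoeff, h]))
      rw [hj', hk'] at this
      exact hcond this
  choose T hT hTp using hpiece
  have hsum : ∑' i, schattenSum p (T i) ≤ C₁ * 2 ^ (3 * γ) * ((G * (G * S)) ^ (1 - p) *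
      ((G * G) ^ (p / 2) * (G * G) ^ (p / 2))) * (‖x‖ₑ * ‖y‖ₑ) ^ p := by
    have hX2 : ∑' l, X l ^ (2 : ℝ) ≤ ‖x‖ₑ ^ (2 : ℝ) := by
      simpa using tsum_enorm_coordRestrict_sq_le B 1 tsum_indicator_dyadicLayer_le x
    have hY2 : ∑' l, Y l ^ (2 : ℝ) ≤ ‖y‖ₑ ^ (2 : ℝ) := by
      simpa using tsum_enorm_coordRestrict_sq_le B 1 tsum_indicator_dyadicLayer_le y
    set W : ℕ × ℕ × ℕ → ℝ≥0∞ := fun i => scaleWeight γ i.1 i.2.1 * scaleWeight γ i.1 i.2.2 with hWd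
    have hWA : ∑' i, W i * A i.1 ^ (p / (1 - p)) ≤ G * (G * S) := by
      rw [ENNReal.tsum_prod', hS, ← ENNReal.tsum_mul_left, ← ENNReal.tsum_mul_left]
      refine ENNReal.tsum_le_tsum fun n => ?_
      rw [ENNReal.tsum_prod']
      simp only [hWd, ENNReal.tsum_mul_right, ENNReal.tsum_mul_left]
      rw [mul_assoc]
      gcongr <;> exact hW n
    have hWsum : ∀ U : ℕ → ℝ≥0∞, ∑' n, ∑' l, scaleWeight γ n l * U l ≤ G * ∑' l, U l := fun U => by
      rw [ENNReal.tsum_comm, ← ENNReal.tsum_mul_left]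
      refine ENNReal.tsum_le_tsum fun l => ?_
      rw [ENNReal.tsum_mul_right]
      simp only [scaleWeight_comm γ _ l]
      gcongr
      exact hW l
    have hWX : ∑' i, W i * X i.2.1 ^ (2 : ℝ) ≤ G * G * ‖x‖ₑ ^ (2 : ℝ) := by
      calc _ = ∑' n, ∑' l, scaleWeight γ n l * X l ^ (2 : ℝ) * ∑' m, scaleWeight γ n m := by
            simp only [ENNReal.tsum_prod', hWd, mul_right_comm _ _ (X _ ^ (2 : ℝ)),
              ENNReal.tsum_mul_left]
        _ ≤ ∑' n, ∑' l, scaleWeight γ n l * X l ^ (2 : ℝ) * G := by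
            gcongr with n l
            exact hW n
        _ ≤ G * (∑' l, X l ^ (2 : ℝ)) * G := by
            simp only [ENNReal.tsum_mul_right]
            gcongr
            exact hWsum _
        _ ≤ G * ‖x‖ₑ ^ (2 : ℝ) * G := by gcongr
        _ = _ := by ring
    have hWY : ∑' i, W i * Y i.2.2 ^ (2 : ℝ) ≤ G * G * ‖y‖ₑ ^ (2 : ℝ) := by
      calc _ = ∑' n, (∑' l, scaleWeight γ n l) * ∑' m, scaleWeight γ n m * Y m ^ (2 : ℝ) := by
            simp only [ENNReal.tsum_prod', hWd, mul_assoc, ENNReal.tsum_mul_left,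
              ENNReal.tsum_mul_right]
        _ ≤ ∑' n, G * ∑' m, scaleWeight γ n m * Y m ^ (2 : ℝ) := by
            gcongr with n
            exact hW n
        _ ≤ G * (G * ∑' m, Y m ^ (2 : ℝ)) := by
            rw [ENNReal.tsum_mul_left]
            gcongr
            exact hWsum _
        _ ≤ G * (G * ‖y‖ₑ ^ (2 : ℝ)) := by gcongr
        _ = _ := by ring
    calc _ ≤ ∑' i, C₁ * 2 ^ (3 * γ) * (W i * (A i.1 ^ p * (X i.2.1 * Y i.2.2) ^ p)) :=
          ENNReal.tsum_le_tsum hTp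
      _ ≤ C₁ * 2 ^ (3 * γ) * ((G * (G * S)) ^ (1 - p) *
            ((G * G * ‖x‖ₑ ^ (2 : ℝ)) ^ (p / 2) * (G * G * ‖y‖ₑ ^ (2 : ℝ)) ^ (p / 2))) := by
          rw [ENNReal.tsum_mul_left]
          simp only [mul_rpow_mul_rpow_eq hp hp1]
          gcongr
          refine (tsum_rpow_mul_rpow_mul_rpow_le _ _ _ h1p (by linarith) (by ring)).trans ?_
          gcongr
      _ = _ := by
          rw [ENNReal.mul_rpow_of_nonneg _ (‖x‖ₑ ^ (2 : ℝ)) hp2,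
            ENNReal.mul_rpow_of_nonneg _ (‖y‖ₑ ^ (2 : ℝ)) hp2, ← ENNReal.rpow_mul,
            ← ENNReal.rpow_mul, mul_div_cancel₀ p (two_ne_zero (α := ℝ)),
            ENNReal.mul_rpow_of_nonneg ‖x‖ₑ _ hp.le]
          ring
  obtain ⟨R, hR, hRp⟩ := h₃ (ℕ × ℕ × ℕ) T
    (fun j k => hankelMatrix c j k * (x j * (starRingEnd ℂ) (y k)))
    (ne_top_of_le_ne_top (by finiteness) hsum) (fun j k => by
      have hc := (hv.hasSum_blockCoeff c (j + k)).mul_right (x j * (starRingEnd ℂ) (y k))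
      push_cast at hc
      -- The entry at `(j, k)` only sees the pieces indexed by `(n, size j, size k)`.
      have hinj : Function.Injective fun n : ℕ => (n, j.size, k.size) := fun a b h =>
        (Prod.ext_iff.1 h).1
      refine (hinj.hasSum_iff ?_).1 (hc.congr_fun fun n => ?_)
      · rintro ⟨n, l, m⟩ hi
        rw [hT]
        dsimp only
        by_cases hj : j.size = l
        · by_cases hk : k.size = m
          · exact absurd ⟨n, by rw [hj, hk]⟩ hi
          · rw [coordRestrict_apply_of_notMem (show k ∉ B m from hk)]
            simp
        · rw [coordRestrict_apply_of_notMem (show j ∉ B l from hj)]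
          simp
      · simp only [Function.comp_apply, hT]
        rw [coordRestrict_apply_of_mem (show j ∈ B j.size from rfl),
          coordRestrict_apply_of_mem (show k ∈ B k.size from rfl)])
  refine ⟨R, hR, hRp.trans ?_⟩
  rw [mul_assoc C₃]
  gcongr

/-! ### Besov classes and exponents -/

theorem memBesov_restrict {v : ℝ → ℝ} {s : ℝ} {p q : ℝ≥0∞} {ψ : CircleDistribution}
    (hq : 0 < q.toReal) (h : MemBesov v s p q ψ) :
    Memℓp (fun n : ℕ => besovTerm v s p ψ.coeff n) q := by
  rw [MemBesov, memℓp_gen_iff hq] at h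
  exact (memℓp_gen_iff hq).2 (h.comp_injective Nat.cast_injective)

theorem flatExp_pos {p : ℝ} (hp : 0 < p) (hp1 : p ≤ 1) : 0 < flatExp p :=
  div_pos (by linarith) (by linarith)

theorem le_flatExp {p : ℝ} (hp : 0 < p) (hp1 : p ≤ 1) : p ≤ flatExp p := by
  rw [flatExp, le_div_iff₀ (by linarith)]
  nlinarith

theorem flatExp_le_sharp {p r : ℝ} (hp : 0 < p) (hp1 : p < 1) (hr1 : r ≤ 1)
    (h : r ≤ flatExp p) : flatExp r ≤ p / (1 - p) := by
  rw [flatExp, le_div_iff₀ (by linarith)] at h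
  rw [flatExp, div_le_div_iff₀ (by linarith) (by linarith)]
  nlinarith

theorem memBesovPlus_mono {v : ℝ → ℝ} {s p p' q : ℝ} (hpp : p ≤ p')
    {ψ : ℂ → ℂ} (h : MemBesovPlus v s (ENNReal.ofReal p') (ENNReal.ofReal q) ψ) :
    MemBesovPlus v s (ENNReal.ofReal p) (ENNReal.ofReal q) ψ := by
  have := isProbabilityMeasure_unitAddCircle
  refine ⟨h.1, h.2.mono fun n => ?_⟩
  have hmono : MeasureTheory.eLpNorm (besovBlock v (taylorCoeff ψ) n) (ENNReal.ofReal p)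
      MeasureTheory.volume ≤ MeasureTheory.eLpNorm (besovBlock v (taylorCoeff ψ) n)
      (ENNReal.ofReal p') MeasureTheory.volume := by
    refine MeasureTheory.eLpNorm_le_eLpNorm_of_exponent_le (ENNReal.ofReal_le_ofReal hpp) ?_
    rw [besovBlock_eq_trigPoly]
    exact (continuous_trigPoly _ _).aestronglyMeasurable
  unfold besovTerm
  rw [Real.norm_of_nonneg (by positivity)]
  gcongr
  exact eLpNorm_besovBlock_ne_top v _ n _

theorem theorem4 (v : ℝ → ℝ) (hv : IsBesovCutoff v) (p : ℝ) (hp0 : 0 < p) (hp1 : p ≤ 1) :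
    (∀ r : ℝ, p ≤ r → r ≤ min 1 (flatExp p) → ∀ ψ : CircleDistribution,
      MemBesov v (invSharp p) (ENNReal.ofReal r) (ENNReal.ofReal (flatExp r)) ψ →
        IsSchurMultiplier p (hankelMatrix ψ.coeff)) ∧
    (∀ ψ : ℂ → ℂ,
      MemBesovPlus v (invSharp p) (ENNReal.ofReal p) (ENNReal.ofReal (flatExp p)) ψ →
        IsSchurMultiplier p (hankelMatrix (taylorCoeff ψ))) ∧
    (p ≤ 2 / 3 → ∀ ψ : ℂ → ℂ,
      MemBesovPlus v (invSharp p) (ENNReal.ofReal (flatExp p)) (ENNReal.ofReal (flatExp p)) ψ →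
        IsSchurMultiplier p (hankelMatrix (taylorCoeff ψ))) := by
  have hflat := flatExp_pos hp0 hp1
  have h2 : ∀ ψ : ℂ → ℂ,
      MemBesovPlus v (invSharp p) (ENNReal.ofReal p) (ENNReal.ofReal (flatExp p)) ψ →
        IsSchurMultiplier p (hankelMatrix (taylorCoeff ψ)) := fun ψ hψ =>
    isSchurMultiplier_of_tsum_flatExp hp0 hp1 hv (tsum_besovETerm_rpow_ne_top hflat hψ.2)
  refine ⟨fun r hpr hr ψ hψ => ?_, h2, fun _ ψ hψ =>
    h2 ψ (memBesovPlus_mono (le_flatExp hp0 hp1) hψ)⟩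
  have hr1 : r ≤ 1 := hr.trans (min_le_left _ _)
  have hr0 : 0 < r := hp0.trans_le hpr
  have hrflat := flatExp_pos hr0 hr1
  have hψ' := memBesov_restrict (by rwa [ENNReal.toReal_ofReal hrflat.le]) hψ
  rcases hpr.eq_or_lt with rfl | hlt
  · exact isSchurMultiplier_of_tsum_flatExp hp0 hp1 hv (tsum_besovETerm_rpow_ne_top hflat hψ')
  · have hp1' : p < 1 := hlt.trans_le hr1
    have hle := flatExp_le_sharp hp0 hp1' hr1 (hr.trans (min_le_right _ _))
    exact isSchurMultiplier_of_tsum_sharpExp hp0 hlt hr1 hv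
      (tsum_besovETerm_rpow_ne_top (div_pos hp0 (by linarith))
        (hψ'.of_exponent_ge (ENNReal.ofReal_le_ofReal hle)))
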